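/- Let $A\in\mathbb R^{n\times n}$, $B_i\in\mathbb R^{n\times m_i}$ ($i=1,\dots,N$), $B=[B_1\;\cdots\;B_N]$, $m=\sum_i m_i$, and let the pair $(A,B)$ be controllable. Let $\mathcal Q\in\mathbb R^{n\times n}$, $\mathcal Q\succeq 0$, and $\mathcal R\in\mathbb R^{m\times m}$, $\mathcal R\succ 0$ (symmetric matrices). Let $T>0$, $\eta\in\mathbb N$, and let $(x,u)$, $u=[u_1^\top\cdots u_N^\top]^\top$, be an input-state trajectory of $\dot x=Ax+\sum_{i=1}^N B_iu_i$ on $[0,\eta T]$. Suppose that $u$ is piecewise constant and persistently exciting of order $L=n+1$: $u(t+jT)=\mu_j$ for $0\le t<T$, $j=0,\dots,\eta-1$; the block Hankel matrix with $L$ block rows and columns $(\mu_j,\dots,\mu_{j+L-1})$, $0\le j\le\eta-L$, has rank $mL$; and $T$ is not a pathological sampling time, i.e. no two distinct eigenvalues of $A$ have equal real parts and imaginary parts that differ by an integer multiple of $2\pi/T$. For a signal $z$ put $\mathcal H_T(z(t))=[z(t)\;z(t+T)\;\cdots\;z(t+(\eta-1)T)]$, $\mathcal H_S(z)=\int_0^T\mathcal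 H_T(z(\tau))\,d\tau$, $\tilde{\mathcal H}_S(x)=\mathcal H_T(x(T))-\mathcal H_T(x(0))$, and, for $P\in\mathbb R^{n\times n}$, $$\mathcal L(P)=\mathcal H_S(x)^\top\mathcal Q\,\mathcal H_S(x)+\mathcal H_S(u)^\top\mathcal R\,\mathcal H_S(u)+\mathcal H_S(x)^\top P\,\tilde{\mathcal H}_S(x)+\tilde{\mathcal H}_S(x)^\top P\,\mathcal H_S(x).$$ Let $\mathcal P$ be a solution of the optimization problem: maximize $\operatorname{tr}(P)$ subject to $P\succ0$, $\mathcal L(P)\succeq0$. Then there is a matrix $\Gamma^0$ with $$\begin{bmatrix}\mathcal H_S(x)\\ \mathcal L(\mathcal P)\end{bmatrix}\Gamma^0=\begin{bmatrix}I\\0\end{bmatrix},$$ and for every such $\Gamma^0$ the matrices $K_i^0=-\mathcal H_S(u_i)\Gamma^0$, with $K^0=[K_1^{0\top}\cdots K_N^{0\top}]^\top$, satisfy: 1. $K^0$ is the unique optimal gain of the LQR problem with stability defined by $(A,B,\mathcal Q,\mathcal R)$: it is the only matrix $K$ such that, for every initial state $x_0$, the feedback $u=-Kx$ drives $x(t)\to0$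 and minimizes $\int_0^\infty(x^\top\mathcal Qx+u^\top\mathcal Ru)\,dt$ among all inputs for which $x(t)\to0$. 2. If moreover $(A,\mathcal Q^{1/2})$ is detectable, $K^0$ is also the unique optimal gain of the LQR problem without the requirement $x(t)\to0$: it is the only matrix $K$ such that, for every $x_0$, $u=-Kx$ minimizes the same cost among all inputs. 3. $K^0=\mathcal R^{-1}B^\top\mathcal P$. In particular, if $\mathcal R=\operatorname{blkdiag}_i\{R_{ii}\}$, then $K_i^0=R_{ii}^{-1}B_i^\top\mathcal P$ for every $i$. -/

import Mathlib

open MeasureTheory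

namespace DataLQR

noncomputable section

/-! ### Linear systems `ẋ = A x + B u` -/

/-- The pair `(A, B)` is controllable: `[B  AB  ⋯  A^(n-1) B]` has rank `n`. -/
def IsControllable {n : ℕ} {ι : Type*} [Fintype ι]
    (A : Matrix (Fin n) (Fin n) ℝ) (B : Matrix (Fin n) ι ℝ) : Prop :=
  (Matrix.of fun (a : Fin n) (p : Fin n × ι) => (A ^ (p.1 : ℕ) * B) a p.2).rank = n

/-- The pair `(A, Q)` is detectable: every complex eigenvector of `A` in the kernel of `Q` belongs
to an eigenvalue with negative real part. For `Q ⪰ 0` this is detectability of `(A, Q^(1/2))`. -/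
def IsDetectable {n : ℕ} (A Q : Matrix (Fin n) (Fin n) ℝ) : Prop :=
  ∀ (z : ℂ) (v : Fin n → ℂ), v ≠ 0 →
    (A.map Complex.ofReal).mulVec v = z • v → (Q.map Complex.ofReal).mulVec v = 0 → z.re < 0

/-- `x` solves `ẋ = A x + B u` on `[0, τ]` (in the integrated, Carathéodory sense, so that
discontinuous inputs `u` are allowed). -/
structure IsTrajectory {n : ℕ} {ι : Type*} [Fintype ι]
    (A : Matrix (Fin n) (Fin n) ℝ) (B : Matrix (Fin n) ι ℝ)
    (x : ℝ → Fin n → ℝ) (u : ℝ → ι → ℝ) (τ : ℝ) : Prop where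
  continuousOn : ContinuousOn x (Set.Icc 0 τ)
  integrable : IntervalIntegrable u volume 0 τ
  eq : ∀ t ∈ Set.Icc 0 τ, x t = x 0 + ∫ s in (0 : ℝ)..t, (A.mulVec (x s) + B.mulVec (u s))

/-! ### The multiagent system: concatenation over the players -/

/-- The input matrix `[B_1 ⋯ B_N]`. -/
def hcat {n N : ℕ} {m : Fin N → ℕ} (B : ∀ i, Matrix (Fin n) (Fin (m i)) ℝ) :
    Matrix (Fin n) (Σ i, Fin (m i)) ℝ :=
  Matrix.of fun a p => B p.1 a p.2

/-- The matrix with block rows `M_1, …, M_N`. -/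
def vcat {N : ℕ} {m : Fin N → ℕ} {κ : Type*} (M : ∀ i, Matrix (Fin (m i)) κ ℝ) :
    Matrix (Σ i, Fin (m i)) κ ℝ :=
  Matrix.of fun p b => M p.1 p.2 b

/-- The concatenated signal `u = [u_1ᵀ ⋯ u_Nᵀ]ᵀ`. -/
def stack {N : ℕ} {m : Fin N → ℕ} (u : ∀ i, ℝ → Fin (m i) → ℝ) : ℝ → (Σ i, Fin (m i)) → ℝ :=
  fun t p => u p.1 t p.2

/-- `[B_1 ⋯ B_N] u = ∑ B_i u_i`. -/
theorem hcat_mulVec_stack {n N : ℕ} {m : Fin N → ℕ} (B : ∀ i, Matrix (Fin n) (Fin (m i)) ℝ)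
    (u : ∀ i, ℝ → Fin (m i) → ℝ) (t : ℝ) :
    (hcat B).mulVec (stack u t) = ∑ i, (B i).mulVec (u i t) := by
  funext a
  simp [Matrix.mulVec, dotProduct, hcat, stack, Fintype.sum_sigma]

/-! ### Persistently exciting piecewise constant inputs -/

/-- `T` is a pathological sampling time for `A`: two distinct complex eigenvalues of `A` have the
same real part and imaginary parts that differ by a (nonzero) integer multiple of `2π / T`. -/
def IsPathological {n : ℕ} (A : Matrix (Fin n) (Fin n) ℝ) (T : ℝ) : Prop :=
  ∃ z ∈ spectrum ℂ (A.map Complex.ofReal), ∃ w ∈ spectrum ℂ (A.map Complex.ofReal),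
    z ≠ w ∧ z.re = w.re ∧ ∃ k : ℤ, z.im - w.im = k * (2 * Real.pi / T)

/-- The block Hankel matrix with `L` block rows of the sequence `μ_0, …, μ_(η-1)`; its column `j`
is `(μ_j, …, μ_(j+L-1))` for `0 ≤ j ≤ η - L`. -/
def blockHankel {ι : Type*} (η L : ℕ) (μ : ℕ → ι → ℝ) :
    Matrix (Fin L × ι) (Fin (η + 1 - L)) ℝ :=
  Matrix.of fun p j => μ ((j : ℕ) + (p.1 : ℕ)) p.2

/-- On `[0, ηT)`, `u` is a piecewise constant persistently exciting input of order `L`, with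
sampling time `T`, for a system with state matrix `A`. -/
def IsPCPE {n : ℕ} {ι : Type*} [Fintype ι] (A : Matrix (Fin n) (Fin n) ℝ)
    (T : ℝ) (η L : ℕ) (u : ℝ → ι → ℝ) : Prop :=
  ∃ μ : ℕ → ι → ℝ,
    (∀ j < η, ∀ t ∈ Set.Ico 0 T, u (t + j * T) = μ j) ∧
    (blockHankel η L μ).rank = Fintype.card ι * L ∧
    ¬ IsPathological A T

/-! ### Data matrices -/

/-- `H_T(z(t)) = [z(t)  z(t+T)  ⋯  z(t+(η-1)T)]`. -/
def hankelRow {κ : Type*} (T : ℝ) (η : ℕ) (z : ℝ → κ → ℝ) (t : ℝ) : Matrix κ (Fin η) ℝ :=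
  Matrix.of fun a j => z (t + (j : ℕ) * T) a

/-- `H_S(z) = ∫_0^T H_T(z(τ)) dτ`, entry by entry. -/
def dataInt {κ : Type*} (T : ℝ) (η : ℕ) (z : ℝ → κ → ℝ) : Matrix κ (Fin η) ℝ :=
  Matrix.of fun a j => ∫ τ in (0 : ℝ)..T, hankelRow T η z τ a j

/-- `H̃_S(z) = H_T(z(T)) - H_T(z(0))`. -/
def dataDiff {κ : Type*} (T : ℝ) (η : ℕ) (z : ℝ → κ → ℝ) : Matrix κ (Fin η) ℝ :=
  hankelRow T η z T - hankelRow T η z 0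

/-! ### The semidefinite program -/

/-- `𝓛(P) = H_S(x)ᵀ Q H_S(x) + H_S(u)ᵀ R H_S(u) + H_S(x)ᵀ P H̃_S(x) + H̃_S(x)ᵀ P H_S(x)`. -/
def dataL {n N : ℕ} {m : Fin N → ℕ} (T : ℝ) (η : ℕ)
    (x : ℝ → Fin n → ℝ) (u : ∀ i, ℝ → Fin (m i) → ℝ)
    (Q : Matrix (Fin n) (Fin n) ℝ) (R : Matrix (Σ i, Fin (m i)) (Σ i, Fin (m i)) ℝ)
    (P : Matrix (Fin n) (Fin n) ℝ) : Matrix (Fin η) (Fin η) ℝ :=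
  let Hx := dataInt T η x
  let Hu := vcat fun i => dataInt T η (u i)
  let Dx := dataDiff T η x
  Hx.transpose * Q * Hx + Hu.transpose * R * Hu + Hx.transpose * P * Dx + Dx.transpose * P * Hx

/-- The feasible set `{P ≻ 0, 𝓛(P) ⪰ 0}`. -/
def sdpFeasible {n N : ℕ} {m : Fin N → ℕ} (T : ℝ) (η : ℕ)
    (x : ℝ → Fin n → ℝ) (u : ∀ i, ℝ → Fin (m i) → ℝ)
    (Q : Matrix (Fin n) (Fin n) ℝ) (R : Matrix (Σ i, Fin (m i)) (Σ i, Fin (m i)) ℝ) :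
    Set (Matrix (Fin n) (Fin n) ℝ) :=
  {P | P.PosDef ∧ (dataL T η x u Q R P).PosSemidef}

/-- `P` solves `maximize tr P subject to P ≻ 0, 𝓛(P) ⪰ 0`. -/
def IsSDPSolution {n N : ℕ} {m : Fin N → ℕ} (T : ℝ) (η : ℕ)
    (x : ℝ → Fin n → ℝ) (u : ∀ i, ℝ → Fin (m i) → ℝ)
    (Q : Matrix (Fin n) (Fin n) ℝ) (R : Matrix (Σ i, Fin (m i)) (Σ i, Fin (m i)) ℝ)
    (P : Matrix (Fin n) (Fin n) ℝ) : Prop :=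
  P ∈ sdpFeasible T η x u Q R ∧ IsMaxOn Matrix.trace (sdpFeasible T η x u Q R) P

/-! ### The infinite-horizon LQR problem -/

/-- The cost `∫_0^∞ (xᵀ Q x + uᵀ R u) dt ∈ [0, ∞]` (for `Q ⪰ 0`, `R ⪰ 0`). -/
def lqrCost {n : ℕ} {ι : Type*} [Fintype ι] (Q : Matrix (Fin n) (Fin n) ℝ) (R : Matrix ι ι ℝ)
    (p : (ℝ → Fin n → ℝ) × (ℝ → ι → ℝ)) : ENNReal :=
  ∫⁻ t in Set.Ioi (0 : ℝ),
    ENNReal.ofReal (p.1 t ⬝ᵥ Q.mulVec (p.1 t) + p.2 t ⬝ᵥ R.mulVec (p.2 t))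

/-- All state-input pairs `(x, u)` of `ẋ = A x + B u` on `[0, ∞)` with `x(0) = x₀`. -/
def allPairs {n : ℕ} {ι : Type*} [Fintype ι]
    (A : Matrix (Fin n) (Fin n) ℝ) (B : Matrix (Fin n) ι ℝ) (x₀ : Fin n → ℝ) :
    Set ((ℝ → Fin n → ℝ) × (ℝ → ι → ℝ)) :=
  {p | p.1 0 = x₀ ∧ ∀ τ : ℝ, 0 ≤ τ → IsTrajectory A B p.1 p.2 τ}

/-- The pairs `(x, u)` as in `allPairs` with, in addition, `x(t) → 0` as `t → ∞`. -/
def stablePairs {n : ℕ} {ι : Type*} [Fintype ι]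
    (A : Matrix (Fin n) (Fin n) ℝ) (B : Matrix (Fin n) ι ℝ) (x₀ : Fin n → ℝ) :
    Set ((ℝ → Fin n → ℝ) × (ℝ → ι → ℝ)) :=
  {p ∈ allPairs A B x₀ | Filter.Tendsto p.1 Filter.atTop (nhds 0)}

/-- The gain `K` is optimal for the LQR problem with weights `Q`, `R` over the admissible pairs
`adm`: for each initial state, the closed-loop pair with `u = -K x` is admissible and has the
smallest cost among all admissible pairs. -/
def IsOptimalGain {n : ℕ} {ι : Type*} [Fintype ι]
    (adm : (Fin n → ℝ) → Set ((ℝ → Fin n → ℝ) × (ℝ → ι → ℝ)))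
    (Q : Matrix (Fin n) (Fin n) ℝ) (R : Matrix ι ι ℝ) (K : Matrix ι (Fin n) ℝ) : Prop :=
  ∀ x₀, ∃ p ∈ adm x₀, (∀ t, 0 ≤ t → p.2 t = -(K.mulVec (p.1 t))) ∧ IsMinOn (lqrCost Q R) (adm x₀) p

end

end DataLQR

open DataLQR

/-! Integrating the dynamics over each sampling interval gives `H̃_S(x) = A H_S(x) + B H_S(u)`
(`IsTrajectory.dataDiff_eq`). Hence the quadratic form of `𝓛(P)` at `γ` is the dissipation `aᵀQa +
bᵀRb + 2aᵀP(Aa + Bb)` at `a = H_S(x)γ`, `b = H_S(u)γ`. Persistent excitation and non-pathological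
sampling make every pair `(a, b)` attainable (`IsTrajectory.exists_data_eq`), so the data-driven
program is a model-based one: maximize the trace over `P ≻ 0` with nonnegative dissipation.

Completing the square with `K = R⁻¹BᵀP` splits the dissipation into `aᵀSa`, where `S` is the Riccati
residual, and the `R`-square of `b + Ka` (`dissipation_eq`). At a maximizer `S = 0`
(`riccati_eq_zero_of_trace_max`): otherwise a shifted Lyapunov equation yields a nonzero `D ⪰ 0` for
which `P + eD` is still feasible for some `e > 0`, with larger trace. Now `𝓛(P)γ = 0` means exactly
`b = -Ka`, so the linear equation for `Γ` fixes `H_S(u)Γ = -K`, whichever solution is taken.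

Optimality is a verification argument (`isOptimalGain_iff_eq_riccatiGain`): up to time `t` the cost
is `x₀ᵀPx₀ - x(t)ᵀPx(t)` plus the integral of the `R`-square of `u + Kx`. What remains is that `u =
-Kx` is stabilizing, by controllability and `P ≻ 0` (`tendsto_closedLoop`), and that `x(t)ᵀPx(t)`
becomes small along competitors of finite cost. The latter is clear for stable pairs; for all pairs,
detectability is first upgraded to observability by the Riccati equation
(`IsDetectable.isObservable`, `IsObservable.exists_quadForm_lt`). -/

namespace DataLQR

section

open Matrix

/-! ### Quadratic forms, shifted Lyapunov equations, complex eigenvectors of real matrices -/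

section LinearAlgebra

variable {ι κ : Type*} [Fintype ι]

theorem dotProduct_mulVec_comm_of_isHermitian {M : Matrix ι ι ℝ} (hM : M.IsHermitian)
    (a b : ι → ℝ) : a ⬝ᵥ M *ᵥ b = b ⬝ᵥ M *ᵥ a := by
  have h : Mᵀ = M := by simpa [IsHermitian, conjTranspose_eq_transpose_of_trivial] using hM
  rw [dotProduct_comm, ← vecMul_transpose, h, dotProduct_mulVec]

theorem mulVec_dotProduct [Fintype κ] (M : Matrix ι κ ℝ) (a : κ → ℝ) (b : ι → ℝ) :
    (M *ᵥ a) ⬝ᵥ b = a ⬝ᵥ Mᵀ *ᵥ b := by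
  rw [← vecMul_transpose, dotProduct_mulVec]

theorem quadForm_nonneg {M : Matrix ι ι ℝ} (hM : M.PosSemidef) (a : ι → ℝ) :
    0 ≤ a ⬝ᵥ M *ᵥ a := by
  simpa using hM.dotProduct_mulVec_nonneg a

theorem quadForm_pos {M : Matrix ι ι ℝ} (hM : M.PosDef) {a : ι → ℝ} (ha : a ≠ 0) :
    0 < a ⬝ᵥ M *ᵥ a := by
  simpa using hM.dotProduct_mulVec_pos ha

theorem posSemidef_of_quadForm_nonneg {M : Matrix ι ι ℝ} (hM : Mᵀ = M)
    (h : ∀ a, 0 ≤ a ⬝ᵥ M *ᵥ a) : M.PosSemidef :=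
  .of_dotProduct_mulVec_nonneg (by rwa [IsHermitian, conjTranspose_eq_transpose_of_trivial])
    (by simpa using h)

theorem transpose_eq_of_isHermitian {ι : Type*} {M : Matrix ι ι ℝ} (hM : M.IsHermitian) :
    Mᵀ = M := by
  simpa [IsHermitian, conjTranspose_eq_transpose_of_trivial] using hM

theorem mulVec_eq_zero_of_quadForm_eq_zero {M : Matrix ι ι ℝ} (hM : M.PosSemidef) {a : ι → ℝ}
    (ha : a ⬝ᵥ M *ᵥ a = 0) : M *ᵥ a = 0 := by
  classical
  have h := hM.dotProduct_mulVec_zero_iff a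
  simpa using h.1 (by simpa using ha)

/-- By homogeneity it suffices to bound the quotient of the two forms on the compact unit sphere. -/
theorem exists_quadForm_le {R : Matrix ι ι ℝ} (hR : R.PosDef) (M : Matrix ι ι ℝ) :
    ∃ C : ℝ, 0 < C ∧ ∀ w, w ⬝ᵥ M *ᵥ w ≤ C * (w ⬝ᵥ R *ᵥ w) := by
  have hc : ∀ N : Matrix ι ι ℝ, Continuous fun w : ι → ℝ => w ⬝ᵥ N *ᵥ w := fun N => by
    fun_prop
  have hcont : ContinuousOn (fun w : ι → ℝ => (w ⬝ᵥ M *ᵥ w) / (w ⬝ᵥ R *ᵥ w))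
      (Metric.sphere 0 1) := by
    refine (hc M).continuousOn.div (hc R).continuousOn fun w hw => ?_
    have : w ≠ 0 := by rintro rfl; simp at hw
    exact (quadForm_pos hR this).ne'
  obtain ⟨C, hC⟩ := ((isCompact_sphere (0 : ι → ℝ) 1).image_of_continuousOn hcont).bddAbove
  refine ⟨max C 1, by positivity, fun w => ?_⟩
  by_cases hw : w = 0
  · simp [hw]
  have hn : 0 < ‖w‖ := norm_pos_iff.2 hw
  have hpos := quadForm_pos hR hw
  have h1 : ‖w‖⁻¹ • w ∈ Metric.sphere (0 : ι → ℝ) 1 := by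
    simp [norm_smul, hn.ne']
  have h2 := hC ⟨_, h1, rfl⟩
  simp only [mulVec_smul, dotProduct_smul, smul_dotProduct, smul_eq_mul] at h2
  rw [mul_div_mul_left _ _ (by positivity), mul_div_mul_left _ _ (by positivity),
    div_le_iff₀ hpos] at h2
  exact h2.trans (mul_le_mul_of_nonneg_right (le_max_left _ _) hpos.le)

/-- The shift `r` is chosen so that `vᵀAv < r vᵀv` for `v ≠ 0`. At an eigenvector `v` of `D` with
eigenvalue `λ`, the form of the left-hand side is `2λ(r vᵀv - vᵀAv)`, which forces `λ ≥ 0`. No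
stability of `A` is needed. -/
theorem exists_forall_posSemidef_of_lyapunov [DecidableEq ι] (A : Matrix ι ι ℝ) :
    ∃ r : ℝ, 0 < r ∧ ∀ D : Matrix ι ι ℝ, Dᵀ = D →
      ((2 * r) • D - Aᵀ * D - D * A).PosSemidef → D.PosSemidef := by
  obtain ⟨C, hC0, hC⟩ := exists_quadForm_le (PosDef.one (n := ι) (R := ℝ)) A
  refine ⟨C + 1, by positivity, fun D hD hS => ?_⟩
  have hH : D.IsHermitian := by rwa [IsHermitian, conjTranspose_eq_transpose_of_trivial]
  rw [hH.posSemidef_iff_eigenvalues_nonneg]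
  intro i
  set v : ι → ℝ := ⇑(hH.eigenvectorBasis i) with hv
  have hDv : D *ᵥ v = hH.eigenvalues i • v := hH.mulVec_eigenvectorBasis i
  have hv0 : v ≠ 0 := by
    intro h
    have := hH.eigenvectorBasis.orthonormal.ne_zero i
    apply this
    ext j
    exact congrFun h j
  have h1 := quadForm_nonneg hS v
  have hvv : 0 < v ⬝ᵥ v := by simpa using quadForm_pos (PosDef.one (n := ι) (R := ℝ)) hv0
  have h2 := hC v
  simp only [one_mulVec] at h2
  have h3 : v ⬝ᵥ ((2 * (C + 1)) • D - Aᵀ * D - D * A) *ᵥ v =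
      2 * hH.eigenvalues i * ((C + 1) * (v ⬝ᵥ v) - v ⬝ᵥ A *ᵥ v) := by
    have e1 : v ⬝ᵥ Aᵀ *ᵥ v = v ⬝ᵥ A *ᵥ v := by
      rw [← mulVec_dotProduct, dotProduct_comm]
    have e2 : v ⬝ᵥ D *ᵥ (A *ᵥ v) = hH.eigenvalues i * (v ⬝ᵥ A *ᵥ v) := by
      rw [dotProduct_mulVec_comm_of_isHermitian hH, hDv, dotProduct_smul, smul_eq_mul,
        dotProduct_comm]
    simp only [sub_mulVec, smul_mulVec, ← mulVec_mulVec, hDv, dotProduct_sub, dotProduct_smul,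
      mulVec_smul, smul_eq_mul, e1, e2]
    ring
  rw [h3] at h1
  have h4 : 0 < (C + 1) * (v ⬝ᵥ v) - v ⬝ᵥ A *ᵥ v := by linarith
  have := nonneg_of_mul_nonneg_left h1 h4
  simp only [Pi.zero_apply]
  linarith

theorem exists_posSemidef_lyapunov [DecidableEq ι] (A : Matrix ι ι ℝ) :
    ∃ r : ℝ, 0 < r ∧ ∀ S : Matrix ι ι ℝ, S.PosSemidef →
      ∃ D : Matrix ι ι ℝ, D.PosSemidef ∧ (2 * r) • D - Aᵀ * D - D * A = S := by
  obtain ⟨r, hr, h⟩ := exists_forall_posSemidef_of_lyapunov A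
  refine ⟨r, hr, fun S hS => ?_⟩
  let V : Submodule ℝ (Matrix ι ι ℝ) :=
    { carrier := {M | Mᵀ = M}
      add_mem' := fun {a b} ha hb => by
        simp only [Set.mem_ofPred_eq] at *; rw [transpose_add, ha, hb]
      zero_mem' := transpose_zero
      smul_mem' := fun c a ha => by
        simp only [Set.mem_ofPred_eq] at *; rw [transpose_smul, ha] }
  let f : Matrix ι ι ℝ →ₗ[ℝ] Matrix ι ι ℝ :=
    { toFun := fun D => (2 * r) • D - Aᵀ * D - D * A
      map_add' := fun a b => by simp only [smul_add, mul_add, add_mul]; abel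
      map_smul' := fun c a => by
        simp only [smul_sub, mul_smul_comm, smul_mul_assoc, RingHom.id_apply, smul_comm c] }
  have hfV : ∀ D ∈ V, f D ∈ V := fun D hD => by
    change ((2 * r) • D - Aᵀ * D - D * A)ᵀ = (2 * r) • D - Aᵀ * D - D * A
    have hD : Dᵀ = D := hD
    simp only [transpose_sub, transpose_smul, transpose_mul, hD, transpose_transpose]
    abel
  -- If `D` is in the kernel, both `D` and `-D` are positive semidefinite, so `D = 0`; in finite
  -- dimension injectivity gives surjectivity.
  have hinj : Function.Injective (f.restrict hfV) := by
    rw [← LinearMap.ker_eq_bot, LinearMap.ker_eq_bot']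
    rintro ⟨D, hD⟩ h0
    have h0 : (2 * r) • D - Aᵀ * D - D * A = 0 := congrArg Subtype.val h0
    have h1 := h D hD (h0 ▸ PosSemidef.zero)
    have h2 := h (-D) (by rw [transpose_neg, hD]) (by
      have : (2 * r) • (-D) - Aᵀ * (-D) - (-D) * A = 0 := by
        rw [← neg_zero, ← h0]; simp only [smul_neg, mul_neg, neg_mul]; abel
      exact this ▸ PosSemidef.zero)
    have h3 : D.trace = 0 :=
      le_antisymm (by have := h2.trace_nonneg; rw [trace_neg] at this; linarith) h1.trace_nonneg
    exact Subtype.ext (h1.trace_eq_zero_iff.1 h3)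
  obtain ⟨⟨D, hD⟩, hDS⟩ := (LinearMap.injective_iff_surjective.1 hinj)
    ⟨S, transpose_eq_of_isHermitian hS.1⟩
  have hDS : (2 * r) • D - Aᵀ * D - D * A = S := congrArg Subtype.val hDS
  exact ⟨D, h D hD (hDS ▸ hS), hDS⟩

/-- A nonzero subspace invariant under a complex matrix contains an eigenvector. -/
theorem exists_eigenvector_mem [DecidableEq ι] (A : Matrix ι ι ℂ) (p : Submodule ℂ (ι → ℂ))
    (hp : p ≠ ⊥) (hA : ∀ v ∈ p, A *ᵥ v ∈ p) :
    ∃ (z : ℂ) (v : ι → ℂ), v ∈ p ∧ v ≠ 0 ∧ A *ᵥ v = z • v := by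
  have : Nontrivial p := Submodule.nontrivial_iff_ne_bot.2 hp
  obtain ⟨z, hz⟩ := Module.End.exists_eigenvalue (A.mulVecLin.restrict hA)
  obtain ⟨⟨v, hvp⟩, hv⟩ := hz.exists_hasEigenvector
  refine ⟨z, v, hvp, fun h => hv.2 (Subtype.ext h), congrArg Subtype.val hv.apply_eq_smul⟩

theorem re_map_mulVec (M : Matrix κ ι ℝ) (v : ι → ℂ) (i : κ) :
    ((M.map Complex.ofReal *ᵥ v) i).re = (M *ᵥ fun j => (v j).re) i := by
  simp [mulVec, dotProduct]

theorem im_map_mulVec (M : Matrix κ ι ℝ) (v : ι → ℂ) (i : κ) :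
    ((M.map Complex.ofReal *ᵥ v) i).im = (M *ᵥ fun j => (v j).im) i := by
  simp [mulVec, dotProduct]

theorem map_mulVec_eq_zero_iff (M : Matrix κ ι ℝ) (v : ι → ℂ) :
    M.map Complex.ofReal *ᵥ v = 0 ↔
      (M *ᵥ fun j => (v j).re) = 0 ∧ (M *ᵥ fun j => (v j).im) = 0 := by
  simp only [funext_iff, ← re_map_mulVec, ← im_map_mulVec, Pi.zero_apply, Complex.ext_iff,
    Complex.zero_re, Complex.zero_im, forall_and]

theorem re_im_eigen {M : Matrix ι ι ℝ} {v : ι → ℂ} {z : ℂ}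
    (h : M.map Complex.ofReal *ᵥ v = z • v) :
    (M *ᵥ fun j => (v j).re) = z.re • (fun j => (v j).re) - z.im • (fun j => (v j).im) ∧
    (M *ᵥ fun j => (v j).im) = z.re • (fun j => (v j).im) + z.im • (fun j => (v j).re) := by
  constructor <;> funext i
  · rw [← re_map_mulVec, h]; simp
  · rw [← im_map_mulVec, h]; simp

theorem mulVec_surjective_of_rank_eq [Fintype κ] {M : Matrix κ ι ℝ} (h : M.rank = Fintype.card κ)
    (w : κ → ℝ) : ∃ v, M *ᵥ v = w := by
  have : LinearMap.range M.mulVecLin = ⊤ := by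
    apply Submodule.eq_top_of_finrank_eq
    rw [← Matrix.rank, h, Module.finrank_fintype_fun_eq_card]
  obtain ⟨v, hv⟩ := (LinearMap.range_eq_top.1 this) w
  exact ⟨v, hv⟩

theorem eq_zero_of_transpose_mulVec_eq_zero [Fintype κ] {M : Matrix κ ι ℝ}
    (h : M.rank = Fintype.card κ)
    {w : κ → ℝ} (hw : Mᵀ *ᵥ w = 0) : w = 0 := by
  obtain ⟨v, hv⟩ := mulVec_surjective_of_rank_eq h w
  have : w ⬝ᵥ w = 0 := by
    nth_rewrite 1 [← hv]
    rw [mulVec_dotProduct, hw, dotProduct_zero]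
  exact dotProduct_self_eq_zero.1 this

theorem mulVec_surjective_of_transpose_injective [Fintype κ] {M : Matrix κ ι ℝ}
    (h : ∀ w, Mᵀ *ᵥ w = 0 → w = 0) (w : κ → ℝ) : ∃ v, M *ᵥ v = w := by
  classical
  apply mulVec_surjective_of_rank_eq
  rw [← rank_transpose, Matrix.rank, LinearMap.finrank_range_of_inj,
    Module.finrank_fintype_fun_eq_card]
  rw [← LinearMap.ker_eq_bot, LinearMap.ker_eq_bot']
  exact h

end LinearAlgebra

/-! ### Controllability and the Hautus test -/

section Controllability

variable {n : ℕ} {ι : Type*} [Fintype ι]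

theorem IsControllable.eq_zero_of_forall {A : Matrix (Fin n) (Fin n) ℝ} {B : Matrix (Fin n) ι ℝ}
    (h : IsControllable A B) {w : Fin n → ℝ} (hw : ∀ k, (A ^ k * B)ᵀ *ᵥ w = 0) : w = 0 := by
  apply eq_zero_of_transpose_mulVec_eq_zero (h.trans (Fintype.card_fin n).symm)
  funext p
  exact congrFun (hw p.1) p.2

/-- The Popov–Belevitch–Hautus condition for a controllable pair. -/
theorem IsControllable.eq_zero_of_eigenvector {A : Matrix (Fin n) (Fin n) ℝ}
    {B : Matrix (Fin n) ι ℝ} (h : IsControllable A B) {v : Fin n → ℂ} {z : ℂ}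
    (hA : (Aᵀ).map Complex.ofReal *ᵥ v = z • v) (hB : (Bᵀ).map Complex.ofReal *ᵥ v = 0) :
    v = 0 := by
  have key : ∀ k, ((A ^ k * B)ᵀ).map Complex.ofReal *ᵥ v = 0 := by
    intro k
    have hk : ((Aᵀ).map Complex.ofReal) ^ k *ᵥ v = z ^ k • v := by
      induction k with
      | zero => simp
      | succ k ih => rw [pow_succ', ← mulVec_mulVec, ih, mulVec_smul, hA, smul_smul, pow_succ]
    have hm : ((A ^ k * B)ᵀ).map Complex.ofReal =
        (Bᵀ).map Complex.ofReal * ((Aᵀ).map Complex.ofReal) ^ k := by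
      rw [transpose_mul, transpose_pow]
      have := map_pow (Complex.ofRealHom.mapMatrix (m := Fin n)) Aᵀ k
      simp only [RingHom.mapMatrix_apply] at this
      change _ = (Bᵀ).map Complex.ofRealHom * ((Aᵀ).map Complex.ofRealHom) ^ k
      rw [← this, ← Matrix.map_mul]
      rfl
    rw [hm, ← mulVec_mulVec, hk, mulVec_smul, hB, smul_zero]
  have h1 := h.eq_zero_of_forall fun k => ((map_mulVec_eq_zero_iff _ _).1 (key k)).1
  have h2 := h.eq_zero_of_forall fun k => ((map_mulVec_eq_zero_iff _ _).1 (key k)).2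
  funext j
  exact Complex.ext (congrFun h1 j) (congrFun h2 j)

end Controllability

/-! ### Dissipation, the Riccati residual and the trace maximizer -/

section Riccati

variable {σ ι : Type*} [Fintype σ] [Fintype ι]

/-- The running cost plus the derivative of `xᵀ P x` along `ẋ = A x + B u`, at `x = a`, `u = b`. -/
noncomputable def dissipation (A : Matrix σ σ ℝ) (B : Matrix σ ι ℝ) (Q : Matrix σ σ ℝ)
    (R : Matrix ι ι ℝ) (P : Matrix σ σ ℝ) (a : σ → ℝ) (b : ι → ℝ) : ℝ :=
  a ⬝ᵥ Q *ᵥ a + b ⬝ᵥ R *ᵥ b + 2 * (a ⬝ᵥ P *ᵥ (A *ᵥ a + B *ᵥ b))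

/-- The feedback gain `R⁻¹ Bᵀ P`. -/
noncomputable def riccatiGain [DecidableEq ι] (B : Matrix σ ι ℝ) (R : Matrix ι ι ℝ)
    (P : Matrix σ σ ℝ) : Matrix ι σ ℝ :=
  R⁻¹ * Bᵀ * P

/-- The residual of the algebraic Riccati equation. -/
noncomputable def riccati [DecidableEq ι] (A : Matrix σ σ ℝ) (B : Matrix σ ι ℝ) (Q : Matrix σ σ ℝ)
    (R : Matrix ι ι ℝ) (P : Matrix σ σ ℝ) : Matrix σ σ ℝ :=
  Q + P * A + Aᵀ * P - (riccatiGain B R P)ᵀ * R * riccatiGain B R P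

theorem mul_riccatiGain [DecidableEq ι] (B : Matrix σ ι ℝ) {R : Matrix ι ι ℝ} (hR : R.PosDef)
    (P : Matrix σ σ ℝ) : R * riccatiGain B R P = Bᵀ * P := by
  rw [riccatiGain, Matrix.mul_assoc, Matrix.mul_nonsing_inv_cancel_left]
  exact (isUnit_iff_isUnit_det _).1 hR.isUnit

theorem riccati_transpose [DecidableEq ι] (A : Matrix σ σ ℝ) (B : Matrix σ ι ℝ) {Q : Matrix σ σ ℝ}
    {R : Matrix ι ι ℝ} {P : Matrix σ σ ℝ} (hQ : Q.IsHermitian) (hR : R.IsHermitian)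
    (hP : P.IsHermitian) : (riccati A B Q R P)ᵀ = riccati A B Q R P := by
  simp only [riccati, transpose_sub, transpose_add, transpose_mul, transpose_transpose,
    transpose_eq_of_isHermitian hQ, transpose_eq_of_isHermitian hR,
    transpose_eq_of_isHermitian hP, Matrix.mul_assoc]
  abel

/-- Completion of the square in `b`; the mixed terms match because `R K = BᵀP`. -/
theorem dissipation_eq [DecidableEq ι] (A : Matrix σ σ ℝ) (B : Matrix σ ι ℝ) (Q : Matrix σ σ ℝ)
    {R : Matrix ι ι ℝ} {P : Matrix σ σ ℝ} (hR : R.PosDef) (hP : P.IsHermitian)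
    (a : σ → ℝ) (b : ι → ℝ) :
    dissipation A B Q R P a b = a ⬝ᵥ riccati A B Q R P *ᵥ a +
      (b + riccatiGain B R P *ᵥ a) ⬝ᵥ R *ᵥ (b + riccatiGain B R P *ᵥ a) := by
  set K := riccatiGain B R P with hK
  have h1 : ∀ c : ι → ℝ, c ⬝ᵥ R *ᵥ (K *ᵥ a) = a ⬝ᵥ P *ᵥ (B *ᵥ c) := fun c => by
    rw [mulVec_mulVec, hK, mul_riccatiGain B hR, ← mulVec_mulVec, ← mulVec_dotProduct,
      dotProduct_mulVec_comm_of_isHermitian hP]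
  have h2 : (K *ᵥ a) ⬝ᵥ R *ᵥ b = a ⬝ᵥ P *ᵥ (B *ᵥ b) := by
    rw [dotProduct_mulVec_comm_of_isHermitian hR.1, h1]
  have h3 : a ⬝ᵥ Aᵀ *ᵥ (P *ᵥ a) = a ⬝ᵥ P *ᵥ (A *ᵥ a) := by
    rw [← mulVec_dotProduct, dotProduct_mulVec_comm_of_isHermitian hP]
  have h4 : a ⬝ᵥ Kᵀ *ᵥ (R *ᵥ (K *ᵥ a)) = a ⬝ᵥ P *ᵥ (B *ᵥ (K *ᵥ a)) := by
    rw [← mulVec_dotProduct, h1]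
  simp only [dissipation, riccati, ← hK, add_mulVec, sub_mulVec, dotProduct_add, dotProduct_sub,
    mulVec_add, add_dotProduct, ← mulVec_mulVec, h1, h2, h3, h4]
  ring

theorem riccati_posSemidef [DecidableEq ι] {A : Matrix σ σ ℝ} {B : Matrix σ ι ℝ} {Q : Matrix σ σ ℝ}
    {R : Matrix ι ι ℝ} {P : Matrix σ σ ℝ} (hQ : Q.IsHermitian) (hR : R.PosDef)
    (hP : P.IsHermitian) (h : ∀ a b, 0 ≤ dissipation A B Q R P a b) :
    (riccati A B Q R P).PosSemidef := by
  refine posSemidef_of_quadForm_nonneg (riccati_transpose A B hQ hR.1 hP) fun a => ?_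
  have := h a (-(riccatiGain B R P *ᵥ a))
  rw [dissipation_eq A B Q hR hP] at this
  simpa using this

theorem dissipation_add_smul (A : Matrix σ σ ℝ) (B : Matrix σ ι ℝ) (Q : Matrix σ σ ℝ)
    (R : Matrix ι ι ℝ) (P D : Matrix σ σ ℝ) (e : ℝ) (a : σ → ℝ) (b : ι → ℝ) :
    dissipation A B Q R (P + e • D) a b =
      dissipation A B Q R P a b + 2 * e * (a ⬝ᵥ D *ᵥ (A *ᵥ a + B *ᵥ b)) := by
  simp only [dissipation, add_mulVec, smul_mulVec, dotProduct_add, dotProduct_smul, smul_eq_mul]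
  ring

theorem closedLoop_mulVec (A : Matrix σ σ ℝ) (B : Matrix σ ι ℝ) (K : Matrix ι σ ℝ)
    (a : σ → ℝ) (b : ι → ℝ) :
    A *ᵥ a + B *ᵥ b = (A - B * K) *ᵥ a + B *ᵥ (b + K *ᵥ a) := by
  simp only [sub_mulVec, mulVec_add, mulVec_mulVec]
  abel

/-- A positive definite matrix of maximal trace among those with nonnegative dissipation solves the
algebraic Riccati equation. -/
theorem riccati_eq_zero_of_trace_max [DecidableEq σ] [DecidableEq ι]
    {A : Matrix σ σ ℝ} {B : Matrix σ ι ℝ}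
    {Q : Matrix σ σ ℝ} {R : Matrix ι ι ℝ} {P : Matrix σ σ ℝ} (hQ : Q.IsHermitian) (hR : R.PosDef)
    (hP : P.PosDef) (h : ∀ a b, 0 ≤ dissipation A B Q R P a b)
    (hmax : ∀ P' : Matrix σ σ ℝ, P'.PosDef → (∀ a b, 0 ≤ dissipation A B Q R P' a b) →
      P'.trace ≤ P.trace) :
    riccati A B Q R P = 0 := by
  set K := riccatiGain B R P with hK
  set S := riccati A B Q R P with hS
  have hSpsd : S.PosSemidef := riccati_posSemidef hQ hR hP.1 h
  obtain ⟨r, hr, hlyap⟩ := exists_posSemidef_lyapunov (A - B * K)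
  obtain ⟨D, hD, hDS⟩ := hlyap S hSpsd
  obtain ⟨C, hC, hCle⟩ := exists_quadForm_le hR (Bᵀ * D * B)
  -- The step size needs `e ≤ 1` and `e * C ≤ r`, so that the new terms are absorbed by `aᵀSa` and
  -- `wᵀRw` respectively.
  set e : ℝ := r / (r + C) with he
  have he0 : 0 < e := by positivity
  have he1 : e ≤ 1 := by rw [he, div_le_one (by positivity)]; linarith
  have heC : e * C / r ≤ 1 := by
    rw [he, div_le_one hr, div_mul_eq_mul_div, div_le_iff₀ (by positivity)]
    nlinarith
  have hpos : (P + e • D).PosDef := hP.add_posSemidef (hD.smul he0.le)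
  have hfeas : ∀ a b, 0 ≤ dissipation A B Q R (P + e • D) a b := by
    intro a b
    set w := b + K *ᵥ a with hw
    have h1 : dissipation A B Q R P a b = a ⬝ᵥ S *ᵥ a + w ⬝ᵥ R *ᵥ w :=
      dissipation_eq A B Q hR hP.1 a b
    have h2 : 2 * (a ⬝ᵥ D *ᵥ ((A - B * K) *ᵥ a)) = 2 * r * (a ⬝ᵥ D *ᵥ a) - a ⬝ᵥ S *ᵥ a := by
      have e1 : a ⬝ᵥ (A - B * K)ᵀ *ᵥ (D *ᵥ a) = a ⬝ᵥ D *ᵥ ((A - B * K) *ᵥ a) := by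
        rw [← mulVec_dotProduct, dotProduct_mulVec_comm_of_isHermitian hD.1]
      rw [← hDS]
      simp only [sub_mulVec _ (D * (A - B * K)), sub_mulVec (_ • D), dotProduct_sub, smul_mulVec,
        dotProduct_smul, ← mulVec_mulVec, e1, smul_eq_mul]
      ring
    -- This square bounds the mixed term `2aᵀDBw` below by `-(r aᵀDa + C wᵀRw / r)`. The shift `2r`
    -- in the Lyapunov equation provides `2r aᵀDa`, more than enough to cover the first loss.
    have h3 := quadForm_nonneg hD (r • a + B *ᵥ w)
    simp only [mulVec_add, mulVec_smul, dotProduct_add, add_dotProduct, dotProduct_smul,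
      smul_dotProduct, smul_eq_mul] at h3
    rw [dotProduct_mulVec_comm_of_isHermitian hD.1 (B *ᵥ w) a] at h3
    have h4 : (B *ᵥ w) ⬝ᵥ D *ᵥ (B *ᵥ w) ≤ C * (w ⬝ᵥ R *ᵥ w) := by
      refine le_of_eq_of_le ?_ (hCle w)
      rw [mulVec_dotProduct, mulVec_mulVec, mulVec_mulVec, Matrix.mul_assoc]
    have hS0 := quadForm_nonneg hSpsd a
    have hD0 := quadForm_nonneg hD a
    have hR0 := quadForm_nonneg hR.posSemidef w
    have h5 : -(r * (a ⬝ᵥ D *ᵥ a) + C * (w ⬝ᵥ R *ᵥ w) / r) ≤ 2 * (a ⬝ᵥ D *ᵥ (B *ᵥ w)) := by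
      rw [← mul_le_mul_iff_right₀ hr]
      have : r * (C * (w ⬝ᵥ R *ᵥ w) / r) = C * (w ⬝ᵥ R *ᵥ w) := by field_simp
      nlinarith
    have h6 : 0 ≤ (1 - e) * (a ⬝ᵥ S *ᵥ a) := mul_nonneg (by linarith) hS0
    have h7 : 0 ≤ (1 - e * C / r) * (w ⬝ᵥ R *ᵥ w) := mul_nonneg (by linarith) hR0
    have h8 : 0 ≤ e * (r * (a ⬝ᵥ D *ᵥ a)) := by positivity
    have h9 := mul_le_mul_of_nonneg_left h5 he0.le
    have h10 : e * (C * (w ⬝ᵥ R *ᵥ w) / r) = e * C / r * (w ⬝ᵥ R *ᵥ w) := by ring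
    rw [dissipation_add_smul, h1, closedLoop_mulVec A B K a b, ← hw,
      mulVec_add D ((A - B * K) *ᵥ a), dotProduct_add a (D *ᵥ ((A - B * K) *ᵥ a))]
    have h11 : 2 * e * (a ⬝ᵥ D *ᵥ ((A - B * K) *ᵥ a) + a ⬝ᵥ D *ᵥ (B *ᵥ w)) =
        e * (2 * r * (a ⬝ᵥ D *ᵥ a) - a ⬝ᵥ S *ᵥ a) + e * (2 * (a ⬝ᵥ D *ᵥ (B *ᵥ w))) := by
      rw [← h2]; ring
    rw [h11]
    linarith
  have htr := hmax _ hpos hfeas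
  rw [trace_add, trace_smul, smul_eq_mul] at htr
  have hD0 : D.trace = 0 := le_antisymm (by nlinarith) hD.trace_nonneg
  rw [hD.trace_eq_zero_iff] at hD0
  rw [← hDS, hD0]
  simp

end Riccati

/-! ### Observability of the closed loop, and observability from detectability -/

section Observability

variable {n : ℕ}

/-- Every complex eigenvector of `A` is detected by `W`. -/
def IsObservable (A W : Matrix (Fin n) (Fin n) ℝ) : Prop :=
  ∀ (z : ℂ) (v : Fin n → ℂ), v ≠ 0 →
    A.map Complex.ofReal *ᵥ v = z • v → W.map Complex.ofReal *ᵥ v ≠ 0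

theorem IsObservable.exists_posDef {A W : Matrix (Fin n) (Fin n) ℝ} (h : IsObservable A W)
    (hW : W.PosSemidef) :
    ∃ r : ℝ, 0 < r ∧ ∃ S : Matrix (Fin n) (Fin n) ℝ, S.PosDef ∧
      ∀ a, 2 * (a ⬝ᵥ S *ᵥ (A *ᵥ a)) = a ⬝ᵥ W *ᵥ a - 2 * r * (a ⬝ᵥ S *ᵥ a) := by
  -- With `-A` the equation reads `2rS + AᵀS + SA = W`. The kernel of `S` is then `A`-invariant and
  -- contained in that of `W`, so a nonzero kernel would contain an eigenvector that `W` does not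
  -- detect.
  obtain ⟨r, hr, hl⟩ := exists_posSemidef_lyapunov (-A)
  obtain ⟨S, hS, hSW⟩ := hl W hW
  have hquad : ∀ a, 2 * (a ⬝ᵥ S *ᵥ (A *ᵥ a)) = a ⬝ᵥ W *ᵥ a - 2 * r * (a ⬝ᵥ S *ᵥ a) := by
    intro a
    have e1 : a ⬝ᵥ Aᵀ *ᵥ (S *ᵥ a) = a ⬝ᵥ S *ᵥ (A *ᵥ a) := by
      rw [← mulVec_dotProduct, dotProduct_mulVec_comm_of_isHermitian hS.1]
    rw [← hSW]
    simp only [transpose_neg, neg_mul, mul_neg, sub_neg_eq_add, add_mulVec, dotProduct_add,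
      smul_mulVec, dotProduct_smul, ← mulVec_mulVec, e1, smul_eq_mul]
    ring
  have hker : ∀ a, S *ᵥ a = 0 → W *ᵥ a = 0 ∧ S *ᵥ (A *ᵥ a) = 0 := by
    intro a ha
    have hWa : W *ᵥ a = 0 := by
      apply mulVec_eq_zero_of_quadForm_eq_zero hW
      have := hquad a
      rw [dotProduct_mulVec_comm_of_isHermitian hS.1, ha] at this
      simpa using this.symm
    refine ⟨hWa, ?_⟩
    have := congrArg (· *ᵥ a) hSW
    simpa [sub_mulVec, add_mulVec, smul_mulVec, ← mulVec_mulVec, ha, hWa] using this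
  let p : Submodule ℂ (Fin n → ℂ) := LinearMap.ker (S.map Complex.ofReal).mulVecLin
  have hp : ∀ v, v ∈ p ↔ S.map Complex.ofReal *ᵥ v = 0 := fun v => Iff.rfl
  have hpbot : p = ⊥ := by
    by_contra hne
    obtain ⟨z, v, hvp, hv0, hv⟩ := exists_eigenvector_mem (A.map Complex.ofReal) p hne (by
      intro v hv
      rw [hp, map_mulVec_eq_zero_iff] at hv ⊢
      simp only [re_map_mulVec, im_map_mulVec]
      exact ⟨(hker _ hv.1).2, (hker _ hv.2).2⟩)
    refine h z v hv0 hv ?_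
    rw [hp, map_mulVec_eq_zero_iff] at hvp
    rw [map_mulVec_eq_zero_iff]
    exact ⟨(hker _ hvp.1).1, (hker _ hvp.2).1⟩
  refine ⟨r, hr, S, .of_dotProduct_mulVec_pos hS.1 fun {a} ha => ?_, hquad⟩
  rw [star_trivial]
  refine lt_of_le_of_ne (quadForm_nonneg hS a) fun h0 => ha ?_
  have hSa := mulVec_eq_zero_of_quadForm_eq_zero hS h0.symm
  have hmem : (fun j => (a j : ℂ)) ∈ p := by
    rw [hp, map_mulVec_eq_zero_iff]
    refine ⟨by simpa using hSa, ?_⟩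
    simp only [Complex.ofReal_im]
    exact mulVec_zero S
  rw [hpbot, Submodule.mem_bot] at hmem
  funext j
  exact Complex.ofReal_eq_zero.1 (congrFun hmem j)

variable {ι : Type*} [Fintype ι] [DecidableEq ι] {A : Matrix (Fin n) (Fin n) ℝ}
  {B : Matrix (Fin n) ι ℝ} {Q : Matrix (Fin n) (Fin n) ℝ} {R : Matrix ι ι ℝ}
  {P : Matrix (Fin n) (Fin n) ℝ}

/-- A closed-loop eigenvector `v` in the kernel of the weight satisfies `Qv = 0` and `Kv = 0`. Then
`BᵀPv = 0`, and the Riccati equation gives `AᵀPv = -zPv`, so the Hautus test yields `Pv = 0`, whence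
`v = 0`. -/
theorem isObservable_closedLoop (hQ : Q.PosSemidef) (hR : R.PosDef) (hP : P.PosDef)
    (hAB : IsControllable A B) (hric : riccati A B Q R P = 0) :
    IsObservable (A - B * riccatiGain B R P)
      (Q + (riccatiGain B R P)ᵀ * R * riccatiGain B R P) := by
  intro z v hv0 hv hWv
  set K := riccatiGain B R P with hK
  rw [map_mulVec_eq_zero_iff] at hWv
  have hker : ∀ a, (Q + Kᵀ * R * K) *ᵥ a = 0 → Q *ᵥ a = 0 ∧ K *ᵥ a = 0 := by
    intro a ha
    have h1 : a ⬝ᵥ Q *ᵥ a + (K *ᵥ a) ⬝ᵥ R *ᵥ (K *ᵥ a) = 0 := by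
      have := congrArg (a ⬝ᵥ ·) ha
      simpa [add_mulVec, dotProduct_add, ← mulVec_mulVec, ← mulVec_dotProduct] using this
    have h2 := quadForm_nonneg hQ a
    have h3 := quadForm_nonneg hR.posSemidef (K *ᵥ a)
    refine ⟨mulVec_eq_zero_of_quadForm_eq_zero hQ (by linarith), ?_⟩
    by_contra hne
    linarith [quadForm_pos hR hne]
  have hstep : ∀ a, (Q + Kᵀ * R * K) *ᵥ a = 0 →
      Bᵀ *ᵥ (P *ᵥ a) = 0 ∧ Aᵀ *ᵥ (P *ᵥ a) = -(P *ᵥ ((A - B * K) *ᵥ a)) := by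
    intro a ha
    obtain ⟨hQa, hKa⟩ := hker a ha
    constructor
    · rw [mulVec_mulVec, ← mul_riccatiGain B hR, ← mulVec_mulVec, ← hK, hKa, mulVec_zero]
    · have := congrArg (· *ᵥ a) hric
      simp only [riccati, ← hK, sub_mulVec, add_mulVec, ← mulVec_mulVec, hQa, hKa, mulVec_zero,
        zero_mulVec, zero_add, sub_zero] at this ⊢
      rw [eq_neg_iff_add_eq_zero, add_comm, this]
  obtain ⟨hr1, hr2⟩ := hstep _ hWv.1
  obtain ⟨hi1, hi2⟩ := hstep _ hWv.2
  obtain ⟨er, ei⟩ := re_im_eigen hv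
  have hPv : P.map Complex.ofReal *ᵥ v = 0 := by
    apply hAB.eq_zero_of_eigenvector (z := -z)
    · funext j
      apply Complex.ext
      · rw [re_map_mulVec]
        simp only [re_map_mulVec]
        rw [hr2, er]
        simp [mulVec_sub, mulVec_smul, re_map_mulVec, im_map_mulVec]
      · rw [im_map_mulVec]
        simp only [im_map_mulVec]
        rw [hi2, ei]
        simp [mulVec_add, mulVec_smul, re_map_mulVec, im_map_mulVec]
    · rw [map_mulVec_eq_zero_iff]
      simp only [re_map_mulVec, im_map_mulVec]
      exact ⟨hr1, hi1⟩
  rw [map_mulVec_eq_zero_iff] at hPv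
  have hzero : ∀ a, P *ᵥ a = 0 → a = 0 := fun a ha => by
    by_contra hne
    have := quadForm_pos hP hne
    rw [ha, dotProduct_zero] at this
    exact this.false
  apply hv0
  funext j
  exact Complex.ext (congrFun (hzero _ hPv.1) j) (congrFun (hzero _ hPv.2) j)

/-- On the kernel of `Q` the Riccati equation says that `2cᵀPAc` is the `R`-square of `Kc`, hence
nonnegative. Summed over the real and imaginary parts of an undetected eigenvector, this gives `z.re
≥ 0`, contrary to detectability. -/
theorem IsDetectable.isObservable (h : IsDetectable A Q) (hR : R.PosDef) (hP : P.PosDef)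
    (hric : riccati A B Q R P = 0) : IsObservable A Q := by
  intro z v hv0 hv hQv
  have hz := h z v hv0 hv hQv
  obtain ⟨er, ei⟩ := re_im_eigen hv
  rw [map_mulVec_eq_zero_iff] at hQv
  set a : Fin n → ℝ := fun j => (v j).re with ha
  set b : Fin n → ℝ := fun j => (v j).im with hb
  have key : ∀ c, Q *ᵥ c = 0 → 0 ≤ c ⬝ᵥ P *ᵥ (A *ᵥ c) := by
    intro c hc
    have h1 := dissipation_eq A B Q hR hP.1 c 0
    rw [hric] at h1
    have h2 := quadForm_nonneg hR.posSemidef (riccatiGain B R P *ᵥ c)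
    simp only [dissipation, hc, dotProduct_zero, mulVec_zero, add_zero, zero_add,
      zero_mulVec] at h1
    linarith
  have h1 := key a hQv.1
  have h2 := key b hQv.2
  rw [er] at h1
  rw [ei] at h2
  simp only [mulVec_sub, mulVec_add, mulVec_smul, dotProduct_sub, dotProduct_add,
    dotProduct_smul, smul_eq_mul] at h1 h2
  rw [dotProduct_mulVec_comm_of_isHermitian hP.1 b a] at h2
  have hsum : 0 < a ⬝ᵥ P *ᵥ a + b ⬝ᵥ P *ᵥ b := by
    by_cases ha0 : a = 0
    · have hb0 : b ≠ 0 := fun hb0 => hv0 (funext fun j =>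
        Complex.ext (congrFun ha0 j) (congrFun hb0 j))
      linarith [quadForm_pos hP hb0, quadForm_nonneg hP.posSemidef a]
    · linarith [quadForm_pos hP ha0, quadForm_nonneg hP.posSemidef b]
  nlinarith

end Observability

/-! ### Calculus along Carathéodory trajectories -/

section Trajectories

variable {σ : Type*} [Fintype σ]

theorem hasDerivAt_exp_mulVec [DecidableEq σ] (A : Matrix σ σ ℝ) (v : σ → ℝ) (t : ℝ) :
    HasDerivAt (fun t : ℝ => NormedSpace.exp (t • A) *ᵥ v)
      (A *ᵥ (NormedSpace.exp (t • A) *ᵥ v)) t := by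
  let _ : NormedRing (Matrix σ σ ℝ) := Matrix.linftyOpNormedRing
  let _ : NormedAlgebra ℝ (Matrix σ σ ℝ) := Matrix.linftyOpNormedAlgebra
  have h := hasDerivAt_exp_smul_const' (𝕂 := ℝ) A t
  let L : Matrix σ σ ℝ →L[ℝ] (σ → ℝ) :=
    LinearMap.toContinuousLinearMap
      { toFun := fun M => M *ᵥ v
        map_add' := fun M N => add_mulVec M N v
        map_smul' := fun c M => smul_mulVec c M v }
  have h2 := L.hasFDerivAt.comp_hasDerivAt t h
  rw [mulVec_mulVec]
  exact h2

theorem hasDerivAt_quadForm {M : Matrix σ σ ℝ} (hM : M.IsHermitian) {y : ℝ → σ → ℝ}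
    {y' : σ → ℝ} {t : ℝ} (hy : HasDerivAt y y' t) :
    HasDerivAt (fun s => y s ⬝ᵥ M *ᵥ y s) (2 * (y t ⬝ᵥ M *ᵥ y')) t := by
  have hy' := hasDerivAt_pi.1 hy
  have h : HasDerivAt (fun s => ∑ i, y s i * ∑ j, M i j * y s j)
      (∑ i, (y' i * (∑ j, M i j * y t j) + y t i * ∑ j, M i j * y' j)) t :=
    HasDerivAt.fun_sum fun i _ => (hy' i).mul
      (HasDerivAt.fun_sum fun j _ => (hy' j).const_mul (M i j))
  convert! h using 1
  have : y' ⬝ᵥ M *ᵥ y t + y t ⬝ᵥ M *ᵥ y' = 2 * (y t ⬝ᵥ M *ᵥ y') := by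
    rw [dotProduct_mulVec_comm_of_isHermitian hM y']; ring
  rw [← this, Finset.sum_add_distrib]
  rfl

/-- Integral product rule for two absolutely continuous functions given by their derivatives. -/
theorem integral_mul_add_mul_of_eq_integral {X Y f g : ℝ → ℝ} {τ : ℝ} (hτ : 0 ≤ τ)
    (hf : IntervalIntegrable f volume 0 τ) (hg : IntervalIntegrable g volume 0 τ)
    (hX : ∀ t ∈ Set.Icc 0 τ, X t = X 0 + ∫ s in (0 : ℝ)..t, f s)
    (hY : ∀ t ∈ Set.Icc 0 τ, Y t = Y 0 + ∫ s in (0 : ℝ)..t, g s) :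
    IntervalIntegrable (fun s => f s * Y s + X s * g s) volume 0 τ ∧
      ∫ s in (0 : ℝ)..τ, (f s * Y s + X s * g s) = X τ * Y τ - X 0 * Y 0 := by
  have hu : Set.uIcc 0 τ = Set.Icc 0 τ := Set.uIcc_of_le hτ
  have hac : ∀ {Z h : ℝ → ℝ}, IntervalIntegrable h volume 0 τ →
      AbsolutelyContinuousOnInterval (fun t => Z 0 + ∫ s in (0 : ℝ)..t, h s) 0 τ := by
    intro Z h hh
    have hconst : AbsolutelyContinuousOnInterval (fun _ : ℝ => Z 0) 0 τ :=
      (LipschitzWith.const (Z 0)).lipschitzOnWith.absolutelyContinuousOnInterval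
    exact hconst.add (hh.absolutelyContinuousOnInterval_intervalIntegral Set.left_mem_uIcc)
  have hcX : ContinuousOn X (Set.uIcc 0 τ) :=
    (hac hf (Z := X)).continuousOn.congr fun t ht => hX t (hu ▸ ht)
  have hcY : ContinuousOn Y (Set.uIcc 0 τ) :=
    (hac hg (Z := Y)).continuousOn.congr fun t ht => hY t (hu ▸ ht)
  refine ⟨(hf.mul_continuousOn hcY).add (hg.continuousOn_mul hcX), ?_⟩
  have hder := (hac hf (Z := X)).integral_deriv_mul_eq_sub (hac hg (Z := Y))
  rw [← hX τ (Set.right_mem_Icc.2 hτ), ← hY τ (Set.right_mem_Icc.2 hτ)] at hder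
  simp only [intervalIntegral.integral_same, add_zero] at hder
  rw [← hder]
  apply intervalIntegral.integral_congr_ae
  filter_upwards [hf.ae_hasDerivAt_integral, hg.ae_hasDerivAt_integral] with s h1 h2 hs
  have hs' : s ∈ Set.uIcc 0 τ := Set.uIoc_subset_uIcc hs
  rw [((h1 hs' 0 Set.left_mem_uIcc).const_add (X 0)).deriv,
    ((h2 hs' 0 Set.left_mem_uIcc).const_add (Y 0)).deriv, ← hX s (hu ▸ hs'), ← hY s (hu ▸ hs')]

variable {n : ℕ} {ι : Type*} [Fintype ι] {A : Matrix (Fin n) (Fin n) ℝ}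
  {B : Matrix (Fin n) ι ℝ} {x : ℝ → Fin n → ℝ} {u : ℝ → ι → ℝ} {τ : ℝ}

theorem intervalIntegrable_pi {κ : Type*} [Fintype κ] {f : ℝ → κ → ℝ} {a b : ℝ} :
    IntervalIntegrable f volume a b ↔ ∀ i, IntervalIntegrable (fun s => f s i) volume a b := by
  simp only [intervalIntegrable_iff, IntegrableOn, integrable_pi_iff]

theorem intervalIntegrable_fun_sum {κ : Type*} {s : Finset κ} {f : κ → ℝ → ℝ} {a b : ℝ}
    (h : ∀ i ∈ s, IntervalIntegrable (f i) volume a b) :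
    IntervalIntegrable (fun t => ∑ i ∈ s, f i t) volume a b := by
  have := IntervalIntegrable.sum s h
  rwa [Finset.sum_fn] at this

theorem IsTrajectory.integrable_rhs (h : IsTrajectory A B x u τ) (hτ : 0 ≤ τ) :
    IntervalIntegrable (fun s => A *ᵥ x s + B *ᵥ u s) volume 0 τ := by
  have hu : Set.uIcc 0 τ = Set.Icc 0 τ := Set.uIcc_of_le hτ
  have hA : Continuous fun v : Fin n → ℝ => A *ᵥ v := by fun_prop
  refine .add (ContinuousOn.intervalIntegrable ?_) ?_
  · rw [hu]; exact hA.comp_continuousOn h.continuousOn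
  · have := h.integrable
    rw [intervalIntegrable_pi] at this ⊢
    intro i
    simp only [mulVec, dotProduct]
    exact intervalIntegrable_fun_sum fun j _ => (this j).const_mul (B i j)

theorem IsTrajectory.eq_apply (h : IsTrajectory A B x u τ) {t : ℝ} (ht : t ∈ Set.Icc 0 τ)
    (i : Fin n) : x t i = x 0 i + ∫ s in (0 : ℝ)..t, (A *ᵥ x s + B *ᵥ u s) i := by
  have hint : IntervalIntegrable (fun s => A *ᵥ x s + B *ᵥ u s) volume 0 t :=
    (h.integrable_rhs (ht.1.trans ht.2)).mono_set (by
      rw [Set.uIcc_of_le ht.1, Set.uIcc_of_le (ht.1.trans ht.2)]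
      exact Set.Icc_subset_Icc_right ht.2)
  have h1 := congrFun (h.eq t ht) i
  rw [h1, Pi.add_apply]
  congr 1
  exact ((ContinuousLinearMap.proj (R := ℝ) (φ := fun _ : Fin n => ℝ)
    i).intervalIntegral_comp_comm hint).symm

/-- The state is only absolutely continuous, so the product rule is applied in integrated form to
each product of two coordinates. -/
theorem IsTrajectory.integral_quadForm (h : IsTrajectory A B x u τ) (hτ : 0 ≤ τ)
    {M : Matrix (Fin n) (Fin n) ℝ} (hM : M.IsHermitian) :
    IntervalIntegrable (fun s => 2 * (x s ⬝ᵥ M *ᵥ (A *ᵥ x s + B *ᵥ u s))) volume 0 τ ∧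
      ∫ s in (0 : ℝ)..τ, 2 * (x s ⬝ᵥ M *ᵥ (A *ᵥ x s + B *ᵥ u s)) =
        x τ ⬝ᵥ M *ᵥ x τ - x 0 ⬝ᵥ M *ᵥ x 0 := by
  set f : ℝ → Fin n → ℝ := fun s => A *ᵥ x s + B *ᵥ u s with hf
  have hfi : ∀ i, IntervalIntegrable (fun s => f s i) volume 0 τ :=
    intervalIntegrable_pi.1 (h.integrable_rhs hτ)
  have hij := fun i j => integral_mul_add_mul_of_eq_integral (X := fun s => x s i)
    (Y := fun s => x s j) hτ (hfi i) (hfi j) (fun t ht => h.eq_apply ht i)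
    (fun t ht => h.eq_apply ht j)
  have hexp : ∀ a b : Fin n → ℝ, a ⬝ᵥ M *ᵥ b = ∑ i, ∑ j, M i j * (a i * b j) := by
    intro a b
    simp only [dotProduct, mulVec, Finset.mul_sum]
    refine Finset.sum_congr rfl fun i _ => Finset.sum_congr rfl fun j _ => by ring
  have hfun : (fun s => 2 * (x s ⬝ᵥ M *ᵥ f s)) =
      fun s => ∑ i, ∑ j, M i j * (f s i * x s j + x s i * f s j) := by
    funext s
    have : 2 * (x s ⬝ᵥ M *ᵥ f s) = f s ⬝ᵥ M *ᵥ x s + x s ⬝ᵥ M *ᵥ f s := by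
      rw [dotProduct_mulVec_comm_of_isHermitian hM (f s)]; ring
    rw [this, hexp, hexp]
    simp only [← Finset.sum_add_distrib, mul_add]
  rw [hfun]
  have hint : ∀ i j, IntervalIntegrable
      (fun s => M i j * (f s i * x s j + x s i * f s j)) volume 0 τ :=
    fun i j => (hij i j).1.const_mul _
  refine ⟨intervalIntegrable_fun_sum fun i _ => intervalIntegrable_fun_sum fun j _ => hint i j, ?_⟩
  rw [intervalIntegral.integral_finsetSum
    fun i _ => intervalIntegrable_fun_sum fun j _ => hint i j]
  simp only [intervalIntegral.integral_finsetSum fun j _ => hint _ j,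
    intervalIntegral.integral_const_mul, (hij _ _).2, hexp, ← Finset.sum_sub_distrib, mul_sub]

/-- A differentiable solution of the closed-loop equation, with its feedback input. -/
theorem isTrajectory_of_hasDerivAt (K : Matrix ι (Fin n) ℝ)
    (h : ∀ t, HasDerivAt x ((A - B * K) *ᵥ x t) t) (τ : ℝ) :
    IsTrajectory A B x (fun t => -(K *ᵥ x t)) τ := by
  have hc : Continuous x := continuous_iff_continuousAt.2 fun t => (h t).continuousAt
  have hKc : Continuous fun t => -(K *ᵥ x t) := by fun_prop
  have hrhs : ∀ s, A *ᵥ x s + B *ᵥ (-(K *ᵥ x s)) = (A - B * K) *ᵥ x s := fun s => by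
    rw [closedLoop_mulVec A B K]; simp
  refine ⟨hc.continuousOn, hKc.intervalIntegrable _ _, fun t _ => ?_⟩
  simp only [hrhs]
  rw [intervalIntegral.integral_eq_sub_of_hasDerivAt (fun s _ => h s)
    (Continuous.intervalIntegrable (by fun_prop) _ _)]
  abel

end Trajectories

/-! ### Upper and lower bounds for the infinite-horizon cost -/

section Cost

variable {n : ℕ} {ι : Type*} [Fintype ι] {A : Matrix (Fin n) (Fin n) ℝ}
  {B : Matrix (Fin n) ι ℝ} {Q : Matrix (Fin n) (Fin n) ℝ} {R : Matrix ι ι ℝ}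
  {P : Matrix (Fin n) (Fin n) ℝ}

/-- Nothing is assumed of `ℓ` beyond the pointwise bound: inputs are only locally integrable, so the
running cost need not be. Passing to the positive part of `h` allows integrands of either sign. -/
theorem ofReal_integral_le_lintegral_Ioi {h ℓ : ℝ → ℝ} {t : ℝ} (ht : 0 ≤ t)
    (hh : IntervalIntegrable h volume 0 t) (hle : ∀ s, 0 < s → h s ≤ ℓ s) :
    ENNReal.ofReal (∫ s in (0 : ℝ)..t, h s) ≤ ∫⁻ s in Set.Ioi (0 : ℝ), ENNReal.ofReal (ℓ s) := by
  have hint : Integrable h (volume.restrict (Set.Ioc 0 t)) :=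
    (intervalIntegrable_iff_integrableOn_Ioc_of_le ht).1 hh
  rw [intervalIntegral.integral_of_le ht]
  calc ENNReal.ofReal (∫ s in Set.Ioc 0 t, h s)
      ≤ ENNReal.ofReal (∫ s in Set.Ioc 0 t, max (h s) 0) :=
        ENNReal.ofReal_le_ofReal (integral_mono hint hint.pos_part fun s => le_max_left _ _)
    _ = ∫⁻ s in Set.Ioc 0 t, ENNReal.ofReal (max (h s) 0) :=
        ofReal_integral_eq_lintegral_ofReal hint.pos_part (ae_of_all _ fun s => le_max_right _ _)
    _ ≤ ∫⁻ s in Set.Ioc 0 t, ENNReal.ofReal (ℓ s) := by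
        refine setLIntegral_mono' measurableSet_Ioc fun s hs => ?_
        rcases le_total (h s) 0 with h0 | h0
        · simp [max_eq_right h0]
        · rw [max_eq_left h0]
          exact ENNReal.ofReal_le_ofReal (hle s hs.1)
    _ ≤ _ := lintegral_mono_set Set.Ioc_subset_Ioi_self

theorem lintegral_Ioi_le_of_integral_le {ℓ : ℝ → ℝ} (hℓ : Continuous ℓ) (h0 : ∀ s, 0 ≤ ℓ s)
    {c : ℝ} (h : ∀ t, 0 ≤ t → ∫ s in (0 : ℝ)..t, ℓ s ≤ c) :
    ∫⁻ s in Set.Ioi (0 : ℝ), ENNReal.ofReal (ℓ s) ≤ ENNReal.ofReal c := by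
  have hU : Set.Ioi (0 : ℝ) = ⋃ k : ℕ, Set.Ioc (0 : ℝ) k := by
    ext s
    simp only [Set.mem_Ioi, Set.mem_iUnion, Set.mem_Ioc, exists_and_left]
    exact ⟨fun hs => ⟨hs, exists_nat_ge s⟩, fun hs => hs.1⟩
  rw [hU, setLIntegral_iUnion_of_directed _
    (Monotone.directed_le fun a b hab => Set.Ioc_subset_Ioc_right (Nat.cast_le.2 hab))]
  refine iSup_le fun k => ?_
  have hk : (0 : ℝ) ≤ k := k.cast_nonneg
  have hint := (intervalIntegrable_iff_integrableOn_Ioc_of_le hk).1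
    (hℓ.intervalIntegrable (μ := volume) 0 k)
  rw [← ofReal_integral_eq_lintegral_ofReal hint (ae_of_all _ h0),
    ← intervalIntegral.integral_of_le hk]
  exact ENNReal.ofReal_le_ofReal (h k hk)

/-- The integrand of the cost. -/
theorem lqrCost_eq (p : (ℝ → Fin n → ℝ) × (ℝ → ι → ℝ)) :
    lqrCost Q R p = ∫⁻ t in Set.Ioi (0 : ℝ),
      ENNReal.ofReal (p.1 t ⬝ᵥ Q *ᵥ p.1 t + p.2 t ⬝ᵥ R *ᵥ p.2 t) := rfl

/-- A lower bound for the cost from a lower bound `g` for the dissipation. -/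
theorem IsTrajectory.ofReal_le_lqrCost {x : ℝ → Fin n → ℝ} {u : ℝ → ι → ℝ} {t : ℝ}
    (h : IsTrajectory A B x u t) (ht : 0 ≤ t) (hP : P.IsHermitian) {g : ℝ → ℝ}
    (hg : IntervalIntegrable g volume 0 t)
    (hgle : ∀ s, 0 < s → g s ≤ dissipation A B Q R P (x s) (u s)) :
    ENNReal.ofReal (x 0 ⬝ᵥ P *ᵥ x 0 - x t ⬝ᵥ P *ᵥ x t + ∫ s in (0 : ℝ)..t, g s) ≤
      lqrCost Q R (x, u) := by
  obtain ⟨h1, h2⟩ := h.integral_quadForm ht hP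
  have h3 := ofReal_integral_le_lintegral_Ioi
    (ℓ := fun s => x s ⬝ᵥ Q *ᵥ x s + u s ⬝ᵥ R *ᵥ u s) ht (hg.sub h1) (fun s hs => by
      have := hgle s hs
      rw [dissipation] at this
      linarith)
  rw [intervalIntegral.integral_sub hg h1, h2] at h3
  rw [lqrCost_eq]
  convert h3 using 2
  ring

end Cost

/-! ### Stability of the Riccati feedback and verification of optimality -/

section OptimalGain

variable {n : ℕ} {ι : Type*} [Fintype ι] {A : Matrix (Fin n) (Fin n) ℝ}
  {B : Matrix (Fin n) ι ℝ} {Q : Matrix (Fin n) (Fin n) ℝ} {R : Matrix ι ι ℝ}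
  {P : Matrix (Fin n) (Fin n) ℝ}

theorem tendsto_zero_of_quadForm {P : Matrix (Fin n) (Fin n) ℝ} (hP : P.PosDef)
    {x : ℝ → Fin n → ℝ}
    (h : Filter.Tendsto (fun t => x t ⬝ᵥ P *ᵥ x t) Filter.atTop (nhds 0)) :
    Filter.Tendsto x Filter.atTop (nhds 0) := by
  obtain ⟨C, -, hC⟩ := exists_quadForm_le hP 1
  have hsq : Filter.Tendsto (fun t => x t ⬝ᵥ x t) Filter.atTop (nhds 0) := by
    refine squeeze_zero (fun t => by simpa using dotProduct_self_star_nonneg (x t))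
      (fun t => by simpa using hC (x t)) ?_
    simpa using h.const_mul C
  rw [tendsto_pi_nhds]
  intro i
  have h2 : Filter.Tendsto (fun t => Real.sqrt (x t ⬝ᵥ x t)) Filter.atTop (nhds 0) := by
    simpa [Function.comp_def] using (Real.continuous_sqrt.tendsto 0).comp hsq
  refine squeeze_zero_norm (fun t => ?_) h2
  rw [Real.norm_eq_abs]
  apply Real.abs_le_sqrt
  rw [sq]
  exact Finset.single_le_sum (f := fun j => x t j * x t j)
    (fun j _ => mul_self_nonneg _) (Finset.mem_univ i)

/-- The Riccati gain is stabilizing. -/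
theorem tendsto_closedLoop [DecidableEq ι] (hQ : Q.PosSemidef) (hR : R.PosDef) (hP : P.PosDef)
    (hAB : IsControllable A B) (hric : riccati A B Q R P = 0) {x : ℝ → Fin n → ℝ}
    (hx : ∀ t, HasDerivAt x ((A - B * riccatiGain B R P) *ᵥ x t) t) :
    Filter.Tendsto x Filter.atTop (nhds 0) := by
  set K := riccatiGain B R P with hK
  have hW : (Q + Kᵀ * R * K).PosSemidef := by
    refine hQ.add ?_
    simpa [conjTranspose_eq_transpose_of_trivial] using hR.posSemidef.conjTranspose_mul_mul_same K
  obtain ⟨r, hr, S, hS, hquad⟩ :=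
    (isObservable_closedLoop hQ hR hP hAB hric).exists_posDef hW
  have hPquad : ∀ a, 2 * (a ⬝ᵥ P *ᵥ ((A - B * K) *ᵥ a)) = -(a ⬝ᵥ (Q + Kᵀ * R * K) *ᵥ a) := by
    intro a
    have h1 := dissipation_eq A B Q hR hP.1 a (-(K *ᵥ a))
    rw [hric, dissipation, closedLoop_mulVec A B K, ← hK] at h1
    simp only [neg_add_cancel, mulVec_zero, zero_mulVec, dotProduct_zero, add_zero, mulVec_neg,
      neg_dotProduct, dotProduct_neg, neg_neg] at h1
    simp only [add_mulVec, dotProduct_add, ← mulVec_mulVec, ← mulVec_dotProduct] at h1 ⊢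
    linarith
  -- Along the closed loop `xᵀPx` alone decreases only by the possibly degenerate form of `Q +
  -- KᵀRK`. Adding `S` cancels this form exactly and leaves the derivative `-2r xᵀSx`, which is
  -- strictly negative away from `0`.
  have hY : (P + S).PosDef := hP.add hS
  obtain ⟨C, hC0, hC⟩ := exists_quadForm_le hS (P + S)
  have hV : ∀ t, HasDerivAt (fun s => x s ⬝ᵥ (P + S) *ᵥ x s)
      (-(2 * r) * (x t ⬝ᵥ S *ᵥ x t)) t := by
    intro t
    have h1 := hasDerivAt_quadForm hY.1 (hx t)
    convert h1 using 1
    rw [add_mulVec, dotProduct_add, mul_add, hPquad, hquad]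
    ring
  set c : ℝ := 2 * r / C with hc
  have hc0 : 0 < c := by positivity
  have hVe : ∀ t, HasDerivAt (fun s => Real.exp (c * s) * (x s ⬝ᵥ (P + S) *ᵥ x s))
      (Real.exp (c * t) * c * (x t ⬝ᵥ (P + S) *ᵥ x t) +
        Real.exp (c * t) * (-(2 * r) * (x t ⬝ᵥ S *ᵥ x t))) t := by
    intro t
    have h1 : HasDerivAt (fun s : ℝ => c * s) c t := by
      simpa using (hasDerivAt_id t).const_mul c
    exact h1.exp.mul (hV t)
  have hanti : Antitone fun s => Real.exp (c * s) * (x s ⬝ᵥ (P + S) *ᵥ x s) := by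
    refine antitone_of_deriv_nonpos (fun t => (hVe t).differentiableAt) fun t => ?_
    rw [(hVe t).deriv]
    have h1 := hC (x t)
    have h2 : c * (x t ⬝ᵥ (P + S) *ᵥ x t) ≤ 2 * r * (x t ⬝ᵥ S *ᵥ x t) := by
      rw [hc, div_mul_eq_mul_div, div_le_iff₀ hC0]
      nlinarith
    have h3 := Real.exp_pos (c * t)
    nlinarith
  apply tendsto_zero_of_quadForm hY
  have hle : ∀ᶠ t in Filter.atTop, x t ⬝ᵥ (P + S) *ᵥ x t ≤
      (x 0 ⬝ᵥ (P + S) *ᵥ x 0) * Real.exp (-(c * t)) := by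
    filter_upwards [Filter.eventually_ge_atTop 0] with t ht
    have h1 := hanti ht
    simp only [mul_zero, Real.exp_zero, one_mul] at h1
    rw [Real.exp_neg, ← div_eq_mul_inv, le_div_iff₀ (Real.exp_pos _)]
    linarith
  refine squeeze_zero' (Filter.Eventually.of_forall fun t => quadForm_nonneg hY.posSemidef _)
    hle ?_
  have h1 : Filter.Tendsto (fun t => Real.exp (-(c * t))) Filter.atTop (nhds 0) :=
    Real.tendsto_exp_neg_atTop_nhds_zero.comp (Filter.tendsto_id.const_mul_atTop hc0)
  simpa using h1.const_mul (x 0 ⬝ᵥ (P + S) *ᵥ x 0)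

/-- Under the Riccati feedback the dissipation vanishes, so the cost up to `t` is `x₀ᵀPx₀ -
x(t)ᵀPx(t)`. -/
theorem exists_closedLoop_pair [DecidableEq ι] (hQ : Q.PosSemidef) (hR : R.PosDef) (hP : P.PosDef)
    (hAB : IsControllable A B) (hric : riccati A B Q R P = 0) (x₀ : Fin n → ℝ) :
    ∃ p ∈ stablePairs A B x₀, (∀ t, p.2 t = -(riccatiGain B R P *ᵥ p.1 t)) ∧
      lqrCost Q R p ≤ ENNReal.ofReal (x₀ ⬝ᵥ P *ᵥ x₀) := by
  set K := riccatiGain B R P with hK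
  set x : ℝ → Fin n → ℝ := fun t => NormedSpace.exp (t • (A - B * K)) *ᵥ x₀ with hx
  have hder : ∀ t, HasDerivAt x ((A - B * K) *ᵥ x t) t := fun t => hasDerivAt_exp_mulVec _ _ t
  have hx0 : x 0 = x₀ := by simp [hx]
  have htraj := isTrajectory_of_hasDerivAt K hder
  refine ⟨(x, fun t => -(K *ᵥ x t)), ⟨⟨hx0, fun τ _ => htraj τ⟩,
    tendsto_closedLoop hQ hR hP hAB hric hder⟩, fun t => rfl, ?_⟩
  have hc : Continuous x := continuous_iff_continuousAt.2 fun t => (hder t).continuousAt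
  rw [lqrCost_eq]
  refine lintegral_Ioi_le_of_integral_le (by fun_prop)
    (fun s => add_nonneg (quadForm_nonneg hQ _) (quadForm_nonneg hR.posSemidef _)) fun t ht => ?_
  have h1 := ((htraj t).integral_quadForm ht hP.1).2
  have h2 : ∀ s, x s ⬝ᵥ Q *ᵥ x s + (-(K *ᵥ x s)) ⬝ᵥ R *ᵥ (-(K *ᵥ x s)) =
      -(2 * (x s ⬝ᵥ P *ᵥ (A *ᵥ x s + B *ᵥ (-(K *ᵥ x s))))) := by
    intro s
    have h3 := dissipation_eq A B Q hR hP.1 (x s) (-(K *ᵥ x s))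
    rw [hric, dissipation, ← hK] at h3
    simp only [neg_add_cancel, mulVec_zero, zero_mulVec, dotProduct_zero, add_zero] at h3
    linarith
  simp only [h2]
  rw [intervalIntegral.integral_neg, h1, hx0]
  linarith [quadForm_nonneg hP.posSemidef (x t)]

/-- Verification theorem for the Riccati gain, for any class of admissible pairs between the stable
ones and all, provided that `xᵀ P x` becomes arbitrarily small along pairs of finite cost. -/
theorem isOptimalGain_iff_eq_riccatiGain [DecidableEq ι]
    (hQ : Q.PosSemidef) (hR : R.PosDef) (hP : P.PosDef)
    (hAB : IsControllable A B) (hric : riccati A B Q R P = 0)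
    {adm : (Fin n → ℝ) → Set ((ℝ → Fin n → ℝ) × (ℝ → ι → ℝ))}
    (hstab : ∀ x₀, stablePairs A B x₀ ⊆ adm x₀) (hall : ∀ x₀, adm x₀ ⊆ allPairs A B x₀)
    (hlim : ∀ x₀, ∀ p ∈ adm x₀, lqrCost Q R p ≠ ⊤ →
      ∀ ε > 0, ∃ t ≥ 1, p.1 t ⬝ᵥ P *ᵥ p.1 t < ε)
    (K : Matrix ι (Fin n) ℝ) :
    IsOptimalGain adm Q R K ↔ K = riccatiGain B R P := by
  have hdiss : ∀ a b, dissipation A B Q R P a b =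
      (b + riccatiGain B R P *ᵥ a) ⬝ᵥ R *ᵥ (b + riccatiGain B R P *ᵥ a) := fun a b => by
    rw [dissipation_eq A B Q hR hP.1, hric, zero_mulVec, dotProduct_zero, zero_add]
  constructor
  · intro hopt
    have hkey : ∀ x₀, (riccatiGain B R P - K) *ᵥ x₀ = 0 := by
      intro x₀
      obtain ⟨⟨x, u⟩, hp, hu, hmin⟩ := hopt x₀
      obtain ⟨q, hq, -, hqcost⟩ := exists_closedLoop_pair hQ hR hP hAB hric x₀
      have hcost : lqrCost Q R (x, u) ≤ ENNReal.ofReal (x₀ ⬝ᵥ P *ᵥ x₀) :=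
        (hmin (hstab x₀ hq)).trans hqcost
      obtain ⟨hx0, htraj⟩ := hall x₀ hp
      simp only at hu hx0 htraj
      set g : ℝ → ℝ := fun s =>
        ((riccatiGain B R P - K) *ᵥ x s) ⬝ᵥ R *ᵥ ((riccatiGain B R P - K) *ᵥ x s) with hg
      have hg0 : ∀ s, 0 ≤ g s := fun s => quadForm_nonneg hR.posSemidef _
      have hgcont : ∀ τ, 0 ≤ τ → ContinuousOn g (Set.Icc 0 τ) := fun τ hτ => by
        have hc : Continuous fun v : Fin n → ℝ =>
          ((riccatiGain B R P - K) *ᵥ v) ⬝ᵥ R *ᵥ ((riccatiGain B R P - K) *ᵥ v) := by fun_prop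
        exact hc.comp_continuousOn (htraj τ hτ).continuousOn
      have hgint : ∀ τ, 0 ≤ τ → IntervalIntegrable g volume 0 τ := fun τ hτ =>
        ContinuousOn.intervalIntegrable (by rw [Set.uIcc_of_le hτ]; exact hgcont τ hτ)
      -- An optimal pair costs at most `x₀ᵀPx₀`, so the excess `∫ g` over `[0, t]` is at most
      -- `x(t)ᵀPx(t)`. Since `t ≥ 1`, this controls the fixed interval `[0, 1]`; continuity of `g`
      -- at `0` then gives `(riccatiGain B R P - K) x₀ = 0`.
      have hsmall : ∀ ε > 0, ∫ s in (0 : ℝ)..1, g s ≤ ε := by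
        intro ε hε
        obtain ⟨t, ht, hVt⟩ := hlim x₀ _ hp (ne_top_of_le_ne_top ENNReal.ofReal_ne_top hcost) ε hε
        have ht0 : (0 : ℝ) ≤ t := by linarith
        have h1 := ((htraj t ht0).ofReal_le_lqrCost (Q := Q) (R := R) ht0 hP.1 (hgint t ht0)
          (fun s hs => by
            rw [hdiss, hu s hs.le, neg_add_eq_sub, ← sub_mulVec])).trans hcost
        rw [hx0, ENNReal.ofReal_le_ofReal_iff (quadForm_nonneg hP.posSemidef _)] at h1
        have h2 : ∫ s in (0 : ℝ)..1, g s ≤ ∫ s in (0 : ℝ)..t, g s :=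
          intervalIntegral.integral_mono_interval le_rfl zero_le_one ht
            (ae_of_all _ hg0) (hgint t ht0)
        simp only at hVt
        linarith
      by_contra hne
      have hpos : 0 < ∫ s in (0 : ℝ)..1, g s := by
        refine intervalIntegral.integral_pos one_pos (hgcont 1 zero_le_one) (fun s _ => hg0 s)
          ⟨0, by simp, ?_⟩
        simp only [hg, hx0]
        exact quadForm_pos hR hne
      linarith [hsmall _ (half_pos hpos)]
    have : riccatiGain B R P - K = 0 := by
      ext i j
      have := congrFun (hkey (Pi.single j 1)) i
      rwa [mulVec_single_one] at this
    exact (sub_eq_zero.1 this).symm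
  · rintro rfl x₀
    obtain ⟨q, hq, hqu, hqcost⟩ := exists_closedLoop_pair hQ hR hP hAB hric x₀
    refine ⟨q, hstab x₀ hq, fun t _ => hqu t, fun p hp => hqcost.trans ?_⟩
    by_cases htop : lqrCost Q R p = ⊤
    · rw [htop]; exact le_top
    obtain ⟨hx0, htraj⟩ := hall x₀ hp
    rw [ENNReal.ofReal_le_iff_le_toReal htop]
    refine le_of_forall_pos_le_add fun ε hε => ?_
    obtain ⟨t, ht, hVt⟩ := hlim x₀ p hp htop ε hε
    have ht0 : (0 : ℝ) ≤ t := by linarith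
    have h1 := (htraj t ht0).ofReal_le_lqrCost (Q := Q) (R := R) (g := fun _ => 0) ht0 hP.1
      intervalIntegrable_const (fun s _ => by
        rw [hdiss]; exact quadForm_nonneg hR.posSemidef _)
    rw [ENNReal.ofReal_le_iff_le_toReal htop, hx0, intervalIntegral.integral_zero] at h1
    linarith

theorem exists_quadForm_lt_of_tendsto {x : ℝ → Fin n → ℝ}
    (h : Filter.Tendsto x Filter.atTop (nhds 0)) {ε : ℝ} (hε : 0 < ε) :
    ∃ t ≥ 1, x t ⬝ᵥ P *ᵥ x t < ε := by
  have hc : Continuous fun v : Fin n → ℝ => v ⬝ᵥ P *ᵥ v := by fun_prop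
  have h1 : Filter.Tendsto (fun t => x t ⬝ᵥ P *ᵥ x t) Filter.atTop (nhds 0) := by
    simpa [Function.comp_def] using (hc.tendsto 0).comp h
  obtain ⟨t, ht⟩ := ((h1.eventually_lt_const hε).and (Filter.eventually_ge_atTop 1)).exists
  exact ⟨t, ht.2, ht.1⟩

/-- Observability supplies `S ≻ 0` whose derivative along the system, plus `r xᵀSx`, is at most a
multiple of the running cost. Finite cost therefore bounds `∫ xᵀSx`, whereas `xᵀPx ≥ ε` from time
`1` on would make this integral grow linearly. -/
theorem IsObservable.exists_quadForm_lt (hobs : IsObservable A Q) (hQ : Q.PosSemidef)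
    (hR : R.PosDef) {x : ℝ → Fin n → ℝ} {u : ℝ → ι → ℝ}
    (htraj : ∀ τ, 0 ≤ τ → IsTrajectory A B x u τ) (hcost : lqrCost Q R (x, u) ≠ ⊤)
    {ε : ℝ} (hε : 0 < ε) : ∃ t ≥ 1, x t ⬝ᵥ P *ᵥ x t < ε := by
  obtain ⟨r, hr, S, hS, hquad⟩ := hobs.exists_posDef hQ
  obtain ⟨C, hC0, hC⟩ := exists_quadForm_le hR (Bᵀ * S * B)
  obtain ⟨D, hD0, hD⟩ := exists_quadForm_le hS P
  -- The `1` pays for the state cost and `C / r` for the mixed term `2aᵀSBb`, estimated with the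
  -- square of `r • a - B b`.
  set c : ℝ := max 1 (C / r) with hc
  have hc0 : 0 < c := lt_max_of_lt_left one_pos
  have hpt : ∀ a b, r * (a ⬝ᵥ S *ᵥ a) + 2 * (a ⬝ᵥ S *ᵥ (A *ᵥ a + B *ᵥ b)) ≤
      c * (a ⬝ᵥ Q *ᵥ a + b ⬝ᵥ R *ᵥ b) := by
    intro a b
    have h3 := quadForm_nonneg hS.posSemidef (r • a - B *ᵥ b)
    simp only [mulVec_sub, mulVec_smul, dotProduct_sub, sub_dotProduct, dotProduct_smul,
      smul_dotProduct, smul_eq_mul] at h3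
    rw [dotProduct_mulVec_comm_of_isHermitian hS.1 (B *ᵥ b) a] at h3
    have h4 : (B *ᵥ b) ⬝ᵥ S *ᵥ (B *ᵥ b) ≤ C * (b ⬝ᵥ R *ᵥ b) := by
      refine le_of_eq_of_le ?_ (hC b)
      rw [mulVec_dotProduct, mulVec_mulVec, mulVec_mulVec, Matrix.mul_assoc]
    have hQ0 := quadForm_nonneg hQ a
    have hR0 := quadForm_nonneg hR.posSemidef b
    have h5 : 2 * (a ⬝ᵥ S *ᵥ (B *ᵥ b)) ≤ r * (a ⬝ᵥ S *ᵥ a) + C / r * (b ⬝ᵥ R *ᵥ b) := by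
      rw [← mul_le_mul_iff_right₀ hr]
      have : r * (C / r * (b ⬝ᵥ R *ᵥ b)) = C * (b ⬝ᵥ R *ᵥ b) := by field_simp
      nlinarith
    have h6 : 1 * (a ⬝ᵥ Q *ᵥ a) ≤ c * (a ⬝ᵥ Q *ᵥ a) :=
      mul_le_mul_of_nonneg_right (le_max_left _ _) hQ0
    have h7 : C / r * (b ⬝ᵥ R *ᵥ b) ≤ c * (b ⬝ᵥ R *ᵥ b) :=
      mul_le_mul_of_nonneg_right (le_max_right _ _) hR0
    have h8 := hquad a
    rw [mulVec_add, dotProduct_add]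
    linarith
  set J : ℝ := (lqrCost Q R (x, u)).toReal with hJ
  have hbound : ∀ t, 0 ≤ t →
      r * (∫ s in (0 : ℝ)..t, x s ⬝ᵥ S *ᵥ x s) ≤ x 0 ⬝ᵥ S *ᵥ x 0 + c * J := by
    intro t ht
    obtain ⟨h1, h2⟩ := (htraj t ht).integral_quadForm ht hS.1
    have hSc : Continuous fun v : Fin n → ℝ => v ⬝ᵥ S *ᵥ v := by fun_prop
    have h3 : IntervalIntegrable (fun s => x s ⬝ᵥ S *ᵥ x s) volume 0 t := by
      apply ContinuousOn.intervalIntegrable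
      rw [Set.uIcc_of_le ht]
      exact hSc.comp_continuousOn (htraj t ht).continuousOn
    have h4 := ofReal_integral_le_lintegral_Ioi
      (ℓ := fun s => x s ⬝ᵥ Q *ᵥ x s + u s ⬝ᵥ R *ᵥ u s) ht
      (((h3.const_mul r).add h1).const_mul c⁻¹) (fun s _ => by
        rw [inv_mul_le_iff₀ hc0]
        exact hpt (x s) (u s))
    rw [intervalIntegral.integral_const_mul] at h4
    rw [intervalIntegral.integral_add (h3.const_mul r) h1, h2,
      intervalIntegral.integral_const_mul] at h4
    change _ ≤ lqrCost Q R (x, u) at h4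
    rw [ENNReal.ofReal_le_iff_le_toReal hcost, inv_mul_le_iff₀ hc0] at h4
    linarith [quadForm_nonneg hS.posSemidef (x t)]
  by_contra! hno
  have hlow : ∀ t, 1 ≤ t → ε / D ≤ x t ⬝ᵥ S *ᵥ x t := fun t ht => by
    rw [div_le_iff₀ hD0]
    linarith [hno t ht, hD (x t)]
  have hSc : Continuous fun v : Fin n → ℝ => v ⬝ᵥ S *ᵥ v := by fun_prop
  have hgrow : ∀ t, 1 ≤ t → (t - 1) * (ε / D) ≤ ∫ s in (0 : ℝ)..t, x s ⬝ᵥ S *ᵥ x s := by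
    intro t ht
    have ht0 : (0 : ℝ) ≤ t := by linarith
    have hcont : ContinuousOn (fun s => x s ⬝ᵥ S *ᵥ x s) (Set.Icc 0 t) :=
      hSc.comp_continuousOn (htraj t ht0).continuousOn
    have hint : IntervalIntegrable (fun s => x s ⬝ᵥ S *ᵥ x s) volume 0 t :=
      ContinuousOn.intervalIntegrable (by rwa [Set.uIcc_of_le ht0])
    have h1 : ∫ s in (1 : ℝ)..t, x s ⬝ᵥ S *ᵥ x s ≤ ∫ s in (0 : ℝ)..t, x s ⬝ᵥ S *ᵥ x s :=
      intervalIntegral.integral_mono_interval zero_le_one ht le_rfl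
        (ae_of_all _ fun s => quadForm_nonneg hS.posSemidef _) hint
    have h2 : ∫ _ in (1 : ℝ)..t, ε / D ≤ ∫ s in (1 : ℝ)..t, x s ⬝ᵥ S *ᵥ x s :=
      intervalIntegral.integral_mono_on ht intervalIntegrable_const
        (hint.mono_set (by
          rw [Set.uIcc_of_le ht, Set.uIcc_of_le ht0]
          exact Set.Icc_subset_Icc_left zero_le_one))
        fun s hs => hlow s hs.1
    rw [intervalIntegral.integral_const, smul_eq_mul] at h2
    linarith
  set b : ℝ := (x 0 ⬝ᵥ S *ᵥ x 0 + c * J) with hb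
  have hb0 : 0 ≤ b := add_nonneg (quadForm_nonneg hS.posSemidef _)
    (mul_nonneg hc0.le ENNReal.toReal_nonneg)
  -- At this time the linear lower bound exceeds the upper bound `b` by `r * (ε / D)`.
  set t : ℝ := 2 + b / (r * (ε / D)) with ht
  have hrD : 0 < r * (ε / D) := by positivity
  have ht1 : 1 ≤ t := by
    have : 0 ≤ b / (r * (ε / D)) := by positivity
    linarith
  have h1 := hgrow t ht1
  have h2 := hbound t (by linarith)
  have h3 : (t - 1) * (r * (ε / D)) = r * (ε / D) + b := by
    rw [ht]; field_simp; ring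
  nlinarith

end OptimalGain

/-! ### Matrix exponentials, their integrals and variation of constants -/

section MatrixExponential

theorem hasDerivAt_mulVec {σ κ : Type*} [Fintype σ] [Fintype κ] (M : Matrix κ σ ℝ)
    {y : ℝ → σ → ℝ} {y' : σ → ℝ} {t : ℝ}
    (h : HasDerivAt y y' t) : HasDerivAt (fun s => M *ᵥ y s) (M *ᵥ y') t := by
  have := (LinearMap.toContinuousLinearMap M.mulVecLin).hasFDerivAt.comp_hasDerivAt t h
  exact this

variable {σ : Type*} [Fintype σ] [DecidableEq σ]

theorem exp_mulVec_of_mulVec_mulVec_eq_zero {N : Matrix σ σ ℂ} {v : σ → ℂ}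
    (h : N *ᵥ (N *ᵥ v) = 0) : NormedSpace.exp N *ᵥ v = v + N *ᵥ v := by
  let _ : NormedRing (Matrix σ σ ℂ) := Matrix.linftyOpNormedRing
  let _ : NormedAlgebra ℂ (Matrix σ σ ℂ) := Matrix.linftyOpNormedAlgebra
  have h1 := NormedSpace.exp_series_hasSum_exp' (𝕂 := ℂ) N
  let L : Matrix σ σ ℂ →L[ℂ] (σ → ℂ) :=
    LinearMap.toContinuousLinearMap
      { toFun := fun M => M *ᵥ v
        map_add' := fun M N => add_mulVec M N v
        map_smul' := fun c M => smul_mulVec c M v }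
  have h2 : HasSum (fun k : ℕ => ((k.factorial : ℂ)⁻¹ • N ^ k) *ᵥ v)
      (NormedSpace.exp N *ᵥ v) := L.hasSum h1
  have h3 : HasSum (fun k : ℕ => ((k.factorial : ℂ)⁻¹ • N ^ k) *ᵥ v)
      (∑ k ∈ Finset.range 2, ((k.factorial : ℂ)⁻¹ • N ^ k) *ᵥ v) :=
    hasSum_sum_of_ne_finset_zero (by
      intro k hk
      obtain ⟨l, rfl⟩ := Nat.exists_eq_add_of_le (not_lt.1 fun h => hk (Finset.mem_range.2 h))
      rw [smul_mulVec, add_comm, pow_add, ← mulVec_mulVec, pow_two, ← mulVec_mulVec, h,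
        mulVec_zero, smul_zero])
  rw [h2.unique h3]
  simp [Finset.sum_range_succ]

/-- Splitting off the scalar part of `t • f` leaves a commuting `N` with `N²v = 0`, so the
exponential series at `v` stops after the linear term. The case `w = 0` is that of an eigenvector.
-/
theorem exp_smul_mulVec_of_jordan {f : Matrix σ σ ℂ} {z : ℂ} {v w : σ → ℂ}
    (hv : f *ᵥ v = z • v + w) (hw : f *ᵥ w = z • w) (t : ℝ) :
    NormedSpace.exp (t • f) *ᵥ v = Complex.exp (t * z) • (v + (t : ℂ) • w) := by
  set N : Matrix σ σ ℂ := t • (f - z • (1 : Matrix σ σ ℂ)) with hN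
  have hdec : t • f = diagonal (fun _ : σ => (t : ℂ) * z) + N := by
    rw [hN, smul_sub, ← smul_one_eq_diagonal, mul_smul, Complex.coe_smul]
    abel
  have hcomm : Commute (diagonal (fun _ : σ => (t : ℂ) * z)) N := by
    rw [← smul_one_eq_diagonal]
    exact (Commute.one_left N).smul_left _
  have hNv : N *ᵥ v = (t : ℂ) • w := by
    rw [hN, smul_mulVec, sub_mulVec, smul_mulVec, one_mulVec, hv, add_sub_cancel_left,
      Complex.coe_smul]
  have hNw : N *ᵥ w = 0 := by
    rw [hN, smul_mulVec, sub_mulVec, smul_mulVec, one_mulVec, hw, sub_self, smul_zero]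
  have hNN : N *ᵥ (N *ᵥ v) = 0 := by rw [hNv, mulVec_smul, hNw, smul_zero]
  rw [hdec, Matrix.exp_add_of_commute _ _ hcomm, Matrix.exp_diagonal, ← mulVec_mulVec,
    exp_mulVec_of_mulVec_mulVec_eq_zero hNN, hNv]
  funext i
  rw [mulVec_diagonal, Pi.smul_apply, smul_eq_mul, Pi.coe_exp, Complex.exp_eq_exp_ℂ]

theorem map_exp_smul (A : Matrix σ σ ℝ) (t : ℝ) :
    (NormedSpace.exp (t • A)).map Complex.ofReal =
      NormedSpace.exp (t • A.map Complex.ofReal) := by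
  let _ : NormedRing (Matrix σ σ ℝ) := Matrix.linftyOpNormedRing
  let _ : NormedAlgebra ℝ (Matrix σ σ ℝ) := Matrix.linftyOpNormedAlgebra
  let _ : NormedAlgebra ℚ (Matrix σ σ ℝ) := NormedAlgebra.restrictScalars ℚ ℝ _
  let _ : NormedRing (Matrix σ σ ℂ) := Matrix.linftyOpNormedRing
  have hc : Continuous (Complex.ofRealHom.mapMatrix (m := σ)) :=
    continuous_id.matrix_map Complex.continuous_ofReal
  have h := NormedSpace.map_exp (Complex.ofRealHom.mapMatrix (m := σ)) hc (t • A)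
  have h2 : Complex.ofRealHom.mapMatrix (t • A) = t • A.map Complex.ofReal := by
    ext i j; simp
  rw [h2] at h
  exact h

theorem continuous_exp_smul (A : Matrix σ σ ℝ) :
    Continuous fun t : ℝ => NormedSpace.exp (t • A) := by
  let _ : NormedRing (Matrix σ σ ℝ) := Matrix.linftyOpNormedRing
  let _ : NormedAlgebra ℝ (Matrix σ σ ℝ) := Matrix.linftyOpNormedAlgebra
  exact continuous_iff_continuousAt.2 fun t =>
    (hasDerivAt_exp_smul_const' (𝕂 := ℝ) A t).continuousAt

/-- The matrix `∫₀ᵗ exp(s A) ds`. -/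
noncomputable def expIntegral (A : Matrix σ σ ℝ) (t : ℝ) : Matrix σ σ ℝ :=
  Matrix.of fun i j => ∫ s in (0 : ℝ)..t, NormedSpace.exp (s • A) i j

theorem continuous_exp_smul_apply (A : Matrix σ σ ℝ) (i j : σ) :
    Continuous fun t : ℝ => NormedSpace.exp (t • A) i j :=
  (continuous_exp_smul A).matrix_elem i j

theorem hasDerivAt_expIntegral_mulVec (A : Matrix σ σ ℝ) (v : σ → ℝ) (t : ℝ) :
    HasDerivAt (fun t => expIntegral A t *ᵥ v) (NormedSpace.exp (t • A) *ᵥ v) t := by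
  rw [hasDerivAt_pi]
  intro i
  exact HasDerivAt.fun_sum fun j _ =>
    ((continuous_exp_smul_apply A i j).integral_hasStrictDerivAt 0 t).hasDerivAt.mul_const (v j)

theorem expIntegral_zero (A : Matrix σ σ ℝ) : expIntegral A 0 = 0 := by
  ext i j; simp [expIntegral]

theorem mul_expIntegral_comm (A : Matrix σ σ ℝ) (t : ℝ) :
    A * expIntegral A t = expIntegral A t * A := by
  have hint : ∀ i j, IntervalIntegrable (fun s : ℝ => NormedSpace.exp (s • A) i j) volume 0 t :=
    fun i j => (continuous_exp_smul_apply A i j).intervalIntegrable _ _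
  have hc : ∀ s : ℝ, A * NormedSpace.exp (s • A) = NormedSpace.exp (s • A) * A := fun s =>
    (((Commute.refl A).smul_right s).exp_right).eq
  ext i j
  simp only [mul_apply, expIntegral, of_apply, ← intervalIntegral.integral_const_mul,
    ← intervalIntegral.integral_mul_const]
  rw [← intervalIntegral.integral_finsetSum fun k _ => (hint k j).const_mul _,
    ← intervalIntegral.integral_finsetSum fun k _ => (hint i k).mul_const _]
  congr 1
  funext s
  exact congrFun (congrFun (hc s) i) j

/-- Both sides have the same derivative in `t` and agree at `t = 0`; invertibility of `A` plays no
role. -/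
theorem mul_expIntegral_add_one_mulVec (A : Matrix σ σ ℝ) (t : ℝ) (v : σ → ℝ) :
    A *ᵥ (expIntegral A t *ᵥ v) + v = NormedSpace.exp (t • A) *ᵥ v := by
  have hd : ∀ s, HasDerivAt (fun s => A *ᵥ (expIntegral A s *ᵥ v) + v -
      NormedSpace.exp (s • A) *ᵥ v) 0 s := fun s => by
    have := ((hasDerivAt_mulVec A (hasDerivAt_expIntegral_mulVec A v s)).add_const v).sub
      (hasDerivAt_exp_mulVec A v s)
    rwa [sub_self] at this
  have h := is_const_of_deriv_eq_zero (fun s => (hd s).differentiableAt) (fun s => (hd s).deriv) t 0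
  simp only [expIntegral_zero, zero_mulVec, mulVec_zero, zero_add, zero_smul, NormedSpace.exp_zero,
    one_mulVec, sub_self] at h
  exact sub_eq_zero.1 h

/-- Variation of constants for a constant inhomogeneity. -/
theorem eq_exp_mulVec_add_of_eq_integral (A : Matrix σ σ ℝ) (b : σ → ℝ) {y : ℝ → σ → ℝ} {T : ℝ}
    (hT : 0 ≤ T) (hy : ContinuousOn y (Set.Icc 0 T))
    (h : ∀ t ∈ Set.Icc 0 T, y t = y 0 + ∫ s in (0 : ℝ)..t, (A *ᵥ y s + b)) :
    ∀ t ∈ Set.Icc 0 T, y t = NormedSpace.exp (t • A) *ᵥ y 0 + expIntegral A t *ᵥ b := by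
  -- Extending `y` by its end values makes the integrand continuous on the line, so the primitive
  -- `Y` is two-sidedly differentiable at the end points as well.
  set y₁ : ℝ → σ → ℝ := Set.IccExtend hT (fun t : Set.Icc 0 T => y t) with hy₁
  have hy₁c : Continuous y₁ := (continuousOn_iff_continuous_domRestrict.1 hy).Icc_extend'
  have hy₁eq : ∀ t ∈ Set.Icc 0 T, y₁ t = y t := fun t ht => by
    rw [hy₁, Set.IccExtend_of_mem hT _ ht]
  set Y : ℝ → σ → ℝ := fun t => y 0 + ∫ s in (0 : ℝ)..t, (A *ᵥ y₁ s + b) with hY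
  have hYeq : ∀ t ∈ Set.Icc 0 T, Y t = y t := by
    intro t ht
    rw [h t ht, hY]
    simp only
    congr 1
    refine intervalIntegral.integral_congr fun s hs => ?_
    rw [Set.uIcc_of_le ht.1] at hs
    simp only [hy₁eq s ⟨hs.1, hs.2.trans ht.2⟩]
  have hYd : ∀ t ∈ Set.Icc 0 T, HasDerivAt Y (A *ᵥ Y t + b) t := by
    intro t ht
    have hc : Continuous fun s => A *ᵥ y₁ s + b := by fun_prop
    have := (hc.integral_hasStrictDerivAt 0 t).hasDerivAt.const_add (y 0)
    rw [hYeq t ht, ← hy₁eq t ht]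
    exact this
  set Z : ℝ → σ → ℝ := fun t => NormedSpace.exp (t • A) *ᵥ y 0 + expIntegral A t *ᵥ b with hZ
  have hZd : ∀ t, HasDerivAt Z (A *ᵥ Z t + b) t := by
    intro t
    convert! (hasDerivAt_exp_mulVec A (y 0) t).add (hasDerivAt_expIntegral_mulVec A b t) using 1
    rw [hZ, mulVec_add, add_assoc, mul_expIntegral_add_one_mulVec]
  obtain ⟨K, hK⟩ : ∃ K, LipschitzWith K fun v : σ → ℝ => A *ᵥ v + b :=
    ⟨_, (LinearMap.toContinuousLinearMap A.mulVecLin).lipschitz.add (LipschitzWith.const b)⟩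
  have huniq := ODE_solution_unique (v := fun _ v => A *ᵥ v + b) (K := K) (f := Y) (g := Z)
    (a := 0) (b := T) (fun _ => hK)
    (fun t ht => (hYd t ht).continuousAt.continuousWithinAt)
    (fun t ht => (hYd t ⟨ht.1, ht.2.le⟩).hasDerivWithinAt)
    (fun t _ => (hZd t).continuousAt.continuousWithinAt)
    (fun t _ => (hZd t).hasDerivWithinAt)
    (by simp [hY, hZ, expIntegral_zero])
  intro t ht
  rw [← hYeq t ht]
  exact huniq ht

end MatrixExponential

/-! ### Non-pathological sampling -/

section Sampling

variable {n : ℕ}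

theorem mem_spectrum_of_transpose_mulVec_eq {M : Matrix (Fin n) (Fin n) ℂ} {v : Fin n → ℂ} {z : ℂ}
    (hv : v ≠ 0) (h : Mᵀ *ᵥ v = z • v) : z ∈ spectrum ℂ M := by
  rw [spectrum.mem_iff]
  intro hu
  have hu' := (isUnit_transpose _).2 hu
  apply hv
  have h0 : (algebraMap ℂ (Matrix (Fin n) (Fin n) ℂ) z - M)ᵀ *ᵥ v = 0 := by
    rw [transpose_sub, sub_mulVec, h, Algebra.algebraMap_eq_smul_one, transpose_smul,
      transpose_one, smul_mulVec, one_mulVec, sub_self]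
  exact mulVec_injective_of_isUnit hu' (h0.trans (mulVec_zero _).symm)

theorem eq_of_exp_eq_of_not_isPathological {A : Matrix (Fin n) (Fin n) ℝ} {T : ℝ} (hT : 0 < T)
    (hA : ¬ IsPathological A T) {z w : ℂ} (hz : z ∈ spectrum ℂ (A.map Complex.ofReal))
    (hw : w ∈ spectrum ℂ (A.map Complex.ofReal))
    (h : Complex.exp (T * z) = Complex.exp (T * w)) : z = w := by
  by_contra hne
  obtain ⟨k, hk⟩ := Complex.exp_eq_exp_iff_exists_int.1 h
  have hre := congrArg Complex.re hk
  have him := congrArg Complex.im hk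
  simp at hre him
  refine hA ⟨z, hz, w, hw, hne, hre.resolve_right hT.ne', k, ?_⟩
  field_simp
  linarith

/-- For `z ≠ 0` the integral is `(exp (Tz) - 1) / z`. If it vanished, then `exp (Tz) = 1`, and the
conjugate of `z`, also an eigenvalue since `A` is real, would have the same exponential.
Non-pathology makes `z` real, and then `z = 0`. -/
theorem integral_exp_ne_zero_of_not_isPathological {A : Matrix (Fin n) (Fin n) ℝ} {T : ℝ}
    (hT : 0 < T) (hA : ¬ IsPathological A T) {v : Fin n → ℂ} {z : ℂ} (hv0 : v ≠ 0)
    (hv : (Aᵀ).map Complex.ofReal *ᵥ v = z • v) :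
    ∫ s in (0 : ℝ)..T, Complex.exp (s * z) ≠ 0 := by
  by_cases hz0 : z = 0
  · simp [hz0, hT.ne']
  have hzs : z ∈ spectrum ℂ (A.map Complex.ofReal) := mem_spectrum_of_transpose_mulVec_eq hv0 hv
  have hcs : (starRingEnd ℂ) z ∈ spectrum ℂ (A.map Complex.ofReal) := by
    refine mem_spectrum_of_transpose_mulVec_eq (v := fun i => (starRingEnd ℂ) (v i)) ?_ ?_
    · intro h0
      exact hv0 (funext fun i => by simpa using congrFun h0 i)
    · obtain ⟨er, ei⟩ := re_im_eigen hv
      change (Aᵀ).map Complex.ofReal *ᵥ _ = _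
      funext i
      apply Complex.ext
      · rw [re_map_mulVec]
        simp only [Complex.conj_re]
        rw [er]; simp
      · rw [im_map_mulVec]
        simp only [Complex.conj_im]
        have : (fun j => -(v j).im) = -fun j => (v j).im := rfl
        rw [this, mulVec_neg, ei]; simp; ring
  have hint : ∫ s in (0 : ℝ)..T, Complex.exp (s * z) = (Complex.exp (T * z) - 1) / z := by
    have := integral_exp_mul_complex (a := 0) (b := T) hz0
    simpa [mul_comm] using this
  rw [hint]
  refine div_ne_zero (fun h1 => hz0 ?_) hz0
  rw [sub_eq_zero] at h1
  have hconj : Complex.exp (T * (starRingEnd ℂ) z) = 1 := by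
    rw [← Complex.conj_ofReal T, ← map_mul, Complex.exp_conj, h1, map_one]
  have hzc := eq_of_exp_eq_of_not_isPathological hT hA hzs hcs (h1.trans hconj.symm)
  obtain ⟨x, rfl⟩ := Complex.conj_eq_iff_real.1 hzc.symm
  have h2 : Real.exp (T * x) = 1 := by exact_mod_cast h1
  rw [Real.exp_eq_one_iff] at h2
  rw [(mul_eq_zero.1 h2).resolve_left hT.ne', Complex.ofReal_zero]

theorem expIntegral_transpose_mulVec_eigenvector {A : Matrix (Fin n) (Fin n) ℝ} (T : ℝ)
    {v : Fin n → ℂ} {z : ℂ} (hv : (Aᵀ).map Complex.ofReal *ᵥ v = z • v) :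
    ((expIntegral A T)ᵀ).map Complex.ofReal *ᵥ v =
      (∫ s in (0 : ℝ)..T, Complex.exp (s * z)) • v := by
  have hs : ∀ s : ℝ, ((NormedSpace.exp (s • A))ᵀ).map Complex.ofReal *ᵥ v =
      Complex.exp (s * z) • v := by
    intro s
    rw [← Matrix.exp_transpose, transpose_smul, map_exp_smul,
      exp_smul_mulVec_of_jordan (w := 0) (by rw [hv, add_zero]) (by simp)]
    simp
  funext i
  have hi : ∀ s : ℝ, ∑ j, ((NormedSpace.exp (s • A) j i : ℝ) : ℂ) * v j =
      Complex.exp (s * z) * v i := fun s => congrFun (hs s) i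
  simp only [mulVec, dotProduct, map_apply, transpose_apply, expIntegral, of_apply,
    Pi.smul_apply, smul_eq_mul]
  simp only [← intervalIntegral.integral_ofReal, ← intervalIntegral.integral_mul_const]
  rw [← intervalIntegral.integral_finsetSum]
  · simp only [hi]
  · intro j _
    exact Continuous.intervalIntegrable ((Complex.continuous_ofReal.comp
      (continuous_exp_smul_apply A j i)).mul_const _) _ _

/-- For a non-pathological sampling time, eigenvectors of `exp (T Aᵀ)` are eigenvectors of `Aᵀ`. -/
theorem exists_eigenvalue_of_exp_eigenvector {A : Matrix (Fin n) (Fin n) ℝ} {T : ℝ} (hT : 0 < T)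
    (hA : ¬ IsPathological A T) {v : Fin n → ℂ} {ρ : ℂ} (hv0 : v ≠ 0)
    (hv : NormedSpace.exp (T • (Aᵀ).map Complex.ofReal) *ᵥ v = ρ • v) :
    ∃ z : ℂ, (Aᵀ).map Complex.ofReal *ᵥ v = z • v := by
  set f : Matrix (Fin n) (Fin n) ℂ := (Aᵀ).map Complex.ofReal with hf
  set G := NormedSpace.exp (T • f) with hG
  have hGf : G * f = f * G := (((Commute.refl f).smul_right T).exp_right).eq.symm
  -- The `ρ`-eigenspace of `G` is invariant under `f`, and by non-pathology `f` has a single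
  -- eigenvalue `z₀` on it.
  let p : Submodule ℂ (Fin n → ℂ) := LinearMap.ker (G - ρ • 1).mulVecLin
  have hp : ∀ w, w ∈ p ↔ G *ᵥ w = ρ • w := fun w => by
    rw [LinearMap.mem_ker, mulVecLin_apply, sub_mulVec, smul_mulVec, one_mulVec, sub_eq_zero]
  have hpf : ∀ w ∈ p, f *ᵥ w ∈ p := fun w hw => by
    rw [hp] at hw ⊢
    rw [mulVec_mulVec, hGf, ← mulVec_mulVec, hw, mulVec_smul]
  have heig : ∀ (z : ℂ) (w : Fin n → ℂ), w ∈ p → w ≠ 0 → f *ᵥ w = z • w →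
      Complex.exp (T * z) = ρ ∧ z ∈ spectrum ℂ (A.map Complex.ofReal) := by
    intro z w hw hw0 hfw
    refine ⟨?_, mem_spectrum_of_transpose_mulVec_eq hw0 hfw⟩
    have h1 := exp_smul_mulVec_of_jordan (w := 0) (hfw.trans (add_zero _).symm) (by simp) T
    rw [(hp w).1 hw, smul_zero, add_zero] at h1
    obtain ⟨i, hi⟩ := Function.ne_iff.1 hw0
    have h2 := congrFun h1 i
    exact (mul_right_cancel₀ hi h2).symm
  obtain ⟨z₀, v₀, hv₀p, hv₀, hfv₀⟩ := exists_eigenvector_mem f p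
    (Submodule.ne_bot_iff _ |>.2 ⟨v, (hp v).2 hv, hv0⟩) hpf
  obtain ⟨hρ, hz₀⟩ := heig z₀ v₀ hv₀p hv₀ hfv₀
  refine ⟨z₀, ?_⟩
  set N : Matrix (Fin n) (Fin n) ℂ := f - z₀ • 1 with hN
  have hNw : ∀ w, N *ᵥ w = f *ᵥ w - z₀ • w := fun w => by
    rw [hN, sub_mulVec, smul_mulVec, one_mulVec]
  by_contra hne
  -- If `f - z₀` were nonzero on `p`, an eigenvector in its image would complete a Jordan chain `w₀,
  -- N w₀`. The exponential then sends `w₀` to `ρ (w₀ + T N w₀)`, which is not `ρ w₀`.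
  obtain ⟨z₁, w, ⟨w₀, hw₀, rfl⟩, hw0, hfw⟩ := exists_eigenvector_mem f
    (p.map N.mulVecLin) (Submodule.ne_bot_iff _ |>.2 ⟨N *ᵥ v, ⟨v, (hp v).2 hv, rfl⟩, by
      rw [hNw]; exact sub_ne_zero.2 hne⟩) (by
      rintro _ ⟨w, hw, rfl⟩
      refine ⟨f *ᵥ w, hpf w hw, ?_⟩
      simp only [mulVecLin_apply, hNw, mulVec_sub, mulVec_smul])
  rw [mulVecLin_apply] at hw0 hfw
  have hNp : N *ᵥ w₀ ∈ p := by
    rw [hNw]; exact p.sub_mem (hpf _ hw₀) (p.smul_mem _ hw₀)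
  obtain ⟨hρ₁, hz₁⟩ := heig z₁ _ hNp hw0 hfw
  obtain rfl := eq_of_exp_eq_of_not_isPathological hT hA hz₁ hz₀ (hρ₁.trans hρ.symm)
  have h1 := exp_smul_mulVec_of_jordan (v := w₀) (w := N *ᵥ w₀) (by rw [hNw]; abel) hfw T
  rw [(hp w₀).1 hw₀, hρ, smul_add, left_eq_add, ← hρ, smul_smul] at h1
  exact hw0 ((smul_eq_zero.1 h1).resolve_left
    (mul_ne_zero (Complex.exp_ne_zero _) (Complex.ofReal_ne_zero.2 hT.ne')))

theorem map_mul_mulVec {α β γ : Type*} [Fintype β] [Fintype γ] (M : Matrix α β ℝ)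
    (N : Matrix β γ ℝ) (v : γ → ℂ) :
    (M * N).map Complex.ofReal *ᵥ v = M.map Complex.ofReal *ᵥ (N.map Complex.ofReal *ᵥ v) := by
  rw [mulVec_mulVec]
  change (M * N).map Complex.ofRealHom *ᵥ v = _
  rw [Matrix.map_mul]; rfl

theorem eq_zero_of_map_mem_bot {M : Submodule ℂ (Fin n → ℂ)} (hM : M = ⊥) {a : Fin n → ℝ}
    (ha : (fun j => (a j : ℂ)) ∈ M) : a = 0 := by
  rw [hM, Submodule.mem_bot] at ha
  funext j
  exact Complex.ofReal_eq_zero.1 (congrFun ha j)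

theorem map_mulVec_ofReal {κ : Type*} (M : Matrix κ (Fin n) ℝ) {a : Fin n → ℝ}
    (h : M *ᵥ a = 0) : M.map Complex.ofReal *ᵥ (fun j => (a j : ℂ)) = 0 := by
  rw [map_mulVec_eq_zero_iff]
  refine ⟨by simpa using h, ?_⟩
  simp only [Complex.ofReal_im]
  exact mulVec_zero M

/-- The kernel is invariant under `Aᵀ` because `A` commutes with its exponential integral; an
eigenvector in it would be scaled by a nonzero integral. -/
theorem expIntegral_transpose_injective {A : Matrix (Fin n) (Fin n) ℝ} {T : ℝ} (hT : 0 < T)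
    (hA : ¬ IsPathological A T) {a : Fin n → ℝ} (ha : (expIntegral A T)ᵀ *ᵥ a = 0) : a = 0 := by
  let p : Submodule ℂ (Fin n → ℂ) :=
    LinearMap.ker (((expIntegral A T)ᵀ).map Complex.ofReal).mulVecLin
  refine eq_zero_of_map_mem_bot (M := p) ?_ (map_mulVec_ofReal _ ha)
  by_contra hne
  obtain ⟨z, v, hvp, hv0, hv⟩ := exists_eigenvector_mem ((Aᵀ).map Complex.ofReal) p hne (by
    intro v hv
    have hv : ((expIntegral A T)ᵀ).map Complex.ofReal *ᵥ v = 0 := hv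
    change ((expIntegral A T)ᵀ).map Complex.ofReal *ᵥ _ = 0
    rw [← map_mul_mulVec, ← transpose_mul, mul_expIntegral_comm, transpose_mul, map_mul_mulVec,
      hv, mulVec_zero])
  have h0 : ((expIntegral A T)ᵀ).map Complex.ofReal *ᵥ v = 0 := hvp
  rw [expIntegral_transpose_mulVec_eigenvector T hv] at h0
  exact (smul_ne_zero (integral_exp_ne_zero_of_not_isPathological hT hA hv0 hv) hv0) h0

/-- Controllability is preserved by sampling with a non-pathological sampling time. -/
theorem IsControllable.sampled {ι : Type*} [Fintype ι] {A : Matrix (Fin n) (Fin n) ℝ}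
    {B : Matrix (Fin n) ι ℝ} (hAB : IsControllable A B) {T : ℝ} (hT : 0 < T)
    (hA : ¬ IsPathological A T) {a : Fin n → ℝ}
    (ha : ∀ k, (NormedSpace.exp (T • A) ^ k * (expIntegral A T * B))ᵀ *ᵥ a = 0) : a = 0 := by
  set E := NormedSpace.exp (T • A) with hE
  set F := expIntegral A T * B with hF
  -- The vectors annihilating all `E ^ k * F` form an `Eᵀ`-invariant space. An eigenvector of `Eᵀ`
  -- in it is one of `Aᵀ`, and `k = 0` puts it in the kernel of `Bᵀ`, contradicting the Hautus test.
  let p : Submodule ℂ (Fin n → ℂ) :=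
    ⨅ k : ℕ, LinearMap.ker (((E ^ k * F)ᵀ).map Complex.ofReal).mulVecLin
  have hp : ∀ v, v ∈ p ↔ ∀ k : ℕ, ((E ^ k * F)ᵀ).map Complex.ofReal *ᵥ v = 0 := fun v => by
    simp only [p, Submodule.mem_iInf, LinearMap.mem_ker, mulVecLin_apply]
  refine eq_zero_of_map_mem_bot (M := p) ?_ ((hp _).2 fun k => map_mulVec_ofReal _ (ha k))
  by_contra hne
  obtain ⟨ρ, v, hvp, hv0, hv⟩ := exists_eigenvector_mem ((Eᵀ).map Complex.ofReal) p hne (by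
    intro v hv
    rw [hp] at hv ⊢
    intro k
    rw [← map_mul_mulVec, ← transpose_mul, ← Matrix.mul_assoc, ← pow_succ']
    exact hv (k + 1))
  rw [hE, ← Matrix.exp_transpose, transpose_smul, map_exp_smul] at hv
  obtain ⟨z, hz⟩ := exists_eigenvalue_of_exp_eigenvector hT hA hv0 hv
  have h0 := (hp v).1 hvp 0
  rw [pow_zero, Matrix.one_mul, hF, transpose_mul, map_mul_mulVec,
    expIntegral_transpose_mulVec_eigenvector T hz, mulVec_smul, smul_eq_zero] at h0
  exact hv0 (hAB.eq_zero_of_eigenvector hz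
    (h0.resolve_left (integral_exp_ne_zero_of_not_isPathological hT hA hv0 hz)))

end Sampling

/-! ### Persistent excitation of a discrete-time system -/

section PersistentExcitation

variable {n : ℕ} {ι : Type*} [Fintype ι]

/-- Left annihilators of `(x_j, μ_j)` vanish for a persistently exciting input sequence of order
`n + 1` of a controllable discrete-time system. -/
theorem eq_zero_of_annihilates_of_blockHankel_rank {E : Matrix (Fin n) (Fin n) ℝ}
    {F : Matrix (Fin n) ι ℝ} {η : ℕ} {x : ℕ → Fin n → ℝ} {μ : ℕ → ι → ℝ}
    (hEF : ∀ a : Fin n → ℝ, (∀ k, (E ^ k * F)ᵀ *ᵥ a = 0) → a = 0)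
    (hx : ∀ j < η, x (j + 1) = E *ᵥ x j + F *ᵥ μ j)
    (hμ : (blockHankel η (n + 1) μ).rank = Fintype.card ι * (n + 1))
    {a : Fin n → ℝ} {b : ι → ℝ} (hab : ∀ j < η, a ⬝ᵥ x j + b ⬝ᵥ μ j = 0) : a = 0 ∧ b = 0 := by
  set g : ℕ → ι → ℝ := fun l => (E ^ l * F)ᵀ *ᵥ a with hg
  have hg' : ∀ l (c : ι → ℝ), a ⬝ᵥ E ^ l *ᵥ (F *ᵥ c) = g l ⬝ᵥ c := fun l c => by
    rw [hg, mulVec_mulVec, mulVec_dotProduct, transpose_transpose]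
  -- The coefficient of `μ (j + i)` once `k` steps of the recursion are unrolled: the new input `i =
  -- k` carries `b`, an earlier one carries `a` transported by `E ^ (k - 1 - i) * F`.
  set h : ℕ → ℕ → ι → ℝ := fun k i => if i < k then g (k - 1 - i) else b with hh
  have hstep : ∀ k j, j + k < η →
      a ⬝ᵥ x (j + k) + b ⬝ᵥ μ (j + k) =
        a ⬝ᵥ E ^ k *ᵥ x j + ∑ i ∈ Finset.range (k + 1), h k i ⬝ᵥ μ (j + i) := by
    intro k
    induction k with
    | zero => intro j _; simp [hh]
    | succ k ih =>
      intro j hj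
      have h1 := ih (j + 1) (by omega)
      rw [show j + (k + 1) = j + 1 + k by omega, h1, hx j (by omega), mulVec_add, dotProduct_add,
        hg', mulVec_mulVec, ← pow_succ, Finset.sum_range_succ' _ (k + 1), add_assoc]
      congr 1
      rw [add_comm]
      congr 1
      · refine Finset.sum_congr rfl fun i _ => ?_
        have : h (k + 1) (i + 1) = h k i := by
          simp only [hh, Nat.add_lt_add_iff_right]
          congr 2
          omega
        rw [this, add_assoc, add_comm 1 i]
  set α : ℕ → ℝ := E.charpoly.coeff with hα
  have hdeg : E.charpoly.natDegree = n := by simp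
  have hαn : α n = 1 := by
    have := (charpoly_monic E).coeff_natDegree
    rwa [hdeg] at this
  have hCH : ∑ k ∈ Finset.range (n + 1), α k • E ^ k = 0 := by
    have := aeval_self_charpoly E
    rwa [Polynomial.aeval_eq_sum_range, hdeg] at this
  -- Weighting the unrolled relations by the characteristic polynomial removes the state by
  -- Cayley–Hamilton. What is left is a relation among `n + 1` consecutive inputs, which the rank of
  -- the Hankel matrix forbids unless every `c i` is zero.
  set c : ℕ → ι → ℝ := fun i => ∑ k ∈ Finset.range (n + 1), if i ≤ k then α k • h k i else 0 with hc
  have hann : ∀ j, j + n < η → ∑ i ∈ Finset.range (n + 1), c i ⬝ᵥ μ (j + i) = 0 := by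
    intro j hj
    have h1 : ∀ k ∈ Finset.range (n + 1), α k * (a ⬝ᵥ E ^ k *ᵥ x j) +
        α k * ∑ i ∈ Finset.range (k + 1), h k i ⬝ᵥ μ (j + i) = 0 := by
      intro k hk
      have hk := Finset.mem_range.1 hk
      rw [← mul_add, ← hstep k j (by omega), hab (j + k) (by omega), mul_zero]
    have h2 := Finset.sum_eq_zero h1
    rw [Finset.sum_add_distrib] at h2
    have h3 : ∑ k ∈ Finset.range (n + 1), α k * (a ⬝ᵥ E ^ k *ᵥ x j) = 0 := by
      have : ∑ k ∈ Finset.range (n + 1), α k * (a ⬝ᵥ E ^ k *ᵥ x j) =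
          a ⬝ᵥ (∑ k ∈ Finset.range (n + 1), α k • E ^ k) *ᵥ x j := by
        rw [sum_mulVec, dotProduct_sum]
        simp only [smul_mulVec, dotProduct_smul, smul_eq_mul]
      rw [this, hCH, zero_mulVec, dotProduct_zero]
    rw [h3, zero_add] at h2
    rw [← h2]
    simp only [hc, sum_dotProduct]
    rw [Finset.sum_comm]
    refine Finset.sum_congr rfl fun k hk => ?_
    have hk := Finset.mem_range.1 hk
    rw [Finset.mul_sum]
    symm
    refine Finset.sum_subset_zero_on_sdiff (fun i hi => ?_) (fun i hi => ?_) fun i hi => ?_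
    · rw [Finset.mem_range] at hi ⊢; omega
    · rw [Finset.mem_sdiff, Finset.mem_range, Finset.mem_range] at hi
      rw [if_neg (by omega), zero_dotProduct]
    · rw [Finset.mem_range] at hi
      rw [if_pos (by omega), smul_dotProduct, smul_eq_mul]
  have hc0 : ∀ i ≤ n, c i = 0 := by
    have hw : (fun p : Fin (n + 1) × ι => c p.1 p.2) = 0 := by
      apply eq_zero_of_transpose_mulVec_eq_zero (M := blockHankel η (n + 1) μ)
      · rw [hμ, Fintype.card_prod, Fintype.card_fin, mul_comm]
      · funext j
        have := hann j (by omega)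
        rw [Finset.sum_range] at this
        simp only [mulVec, dotProduct, transpose_apply, blockHankel, of_apply,
          Fintype.sum_prod_type, Pi.zero_apply]
        rw [← this]
        refine Finset.sum_congr rfl fun i _ => Finset.sum_congr rfl fun p _ => mul_comm _ _
    intro i hi
    funext p
    exact congrFun hw (⟨i, by omega⟩, p)
  have hb : b = 0 := by
    have h1 := hc0 n le_rfl
    rw [hc] at h1
    simp only at h1
    rw [Finset.sum_eq_single n] at h1
    · simpa [hh, hαn] using h1
    · intro k hk hne
      have hk := Finset.mem_range.1 hk
      rw [if_neg (by omega)]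
    · simp
  -- The system `c i = 0` is triangular: `c n = b`, and `c (n - 1 - l)` is `g l` plus multiples of
  -- `b` and of `g l'` with `l' < l`.
  have hglt : ∀ l, l < n → g l = 0 := by
    intro l
    induction l using Nat.strong_induction_on with
    | _ l ih =>
      intro hl
      have h1 := hc0 (n - 1 - l) (by omega)
      rw [hc] at h1
      simp only at h1
      rw [Finset.sum_eq_single n] at h1
      · rw [if_pos (by omega), hαn, one_smul, hh] at h1
        simp only at h1
        rw [if_pos (by omega)] at h1
        rwa [show n - 1 - (n - 1 - l) = l by omega] at h1
      · intro k hk hne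
        have hk := Finset.mem_range.1 hk
        split_ifs with hik
        · rw [hh]
          simp only
          split_ifs with hik'
          · rw [ih _ (by omega) (by omega), smul_zero]
          · rw [hb, smul_zero]
        · rfl
      · simp
  have hg0 : ∀ l, g l = 0 := by
    intro l
    induction l using Nat.strong_induction_on with
    | _ l ih =>
      by_cases hl : l < n
      · exact hglt l hl
      obtain ⟨d, rfl⟩ := Nat.exists_eq_add_of_le (not_lt.1 hl)
      have h1 : ∑ k ∈ Finset.range (n + 1), α k • g (k + d) = 0 := by
        have h2 := congrArg (fun M => (M * (E ^ d * F))ᵀ *ᵥ a) hCH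
        simp only [Matrix.sum_mul, transpose_sum, sum_mulVec, Matrix.smul_mul, transpose_smul,
          smul_mulVec, Matrix.zero_mul, transpose_zero, zero_mulVec, ← Matrix.mul_assoc,
          ← pow_add] at h2
        exact h2
      rw [Finset.sum_range_succ, hαn, one_smul, Finset.sum_eq_zero, zero_add] at h1
      · exact h1
      · intro k hk
        have hk := Finset.mem_range.1 hk
        rw [ih _ (by omega), smul_zero]
  exact ⟨hEF a hg0, hb⟩

end PersistentExcitation

/-! ### Data matrices of a sampled trajectory -/

section Data

variable {n : ℕ} {ι : Type*} [Fintype ι] {A : Matrix (Fin n) (Fin n) ℝ}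
  {B : Matrix (Fin n) ι ℝ} {T : ℝ} {η : ℕ} {x : ℝ → Fin n → ℝ} {u : ℝ → ι → ℝ}

theorem add_mul_mem_Icc {j : ℕ} (hT : 0 < T) (hj : j < η) {t : ℝ} (ht : t ∈ Set.Icc 0 T) :
    t + j * T ∈ Set.Icc 0 (η * T) := by
  have h1 : (j : ℝ) + 1 ≤ η := by exact_mod_cast hj
  have h0 : (0 : ℝ) ≤ j := j.cast_nonneg
  constructor
  · have := ht.1; positivity
  · nlinarith [ht.2]

/-- On each sampling interval the trajectory solves the equation with constant input. -/
theorem IsTrajectory.eq_integral_sample (h : IsTrajectory A B x u (η * T)) (hT : 0 < T) {j : ℕ}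
    (hj : j < η) {c : ι → ℝ} (hu : ∀ t ∈ Set.Ico 0 T, u (t + j * T) = c) :
    ContinuousOn (fun s => x (s + j * T)) (Set.Icc 0 T) ∧
    ∀ t ∈ Set.Icc 0 T, x (t + j * T) =
      x (0 + j * T) + ∫ s in (0 : ℝ)..t, (A *ᵥ x (s + j * T) + B *ᵥ c) := by
  have hmem := fun t (ht : t ∈ Set.Icc 0 T) => add_mul_mem_Icc hT hj ht
  refine ⟨h.continuousOn.comp (by fun_prop) hmem, fun t ht => ?_⟩
  have h0 := hmem 0 ⟨le_rfl, hT.le⟩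
  have ht' := hmem t ht
  have hηT : (0 : ℝ) ≤ η * T := h0.1.trans h0.2
  have hint := h.integrable_rhs hηT
  have hsub : ∀ r ∈ Set.Icc 0 (η * T), IntervalIntegrable
      (fun s => A *ᵥ x s + B *ᵥ u s) volume 0 r := fun r hr => hint.mono_set (by
    rw [Set.uIcc_of_le hr.1, Set.uIcc_of_le hηT]
    exact Set.Icc_subset_Icc_right hr.2)
  have h1 := intervalIntegral.integral_interval_sub_left (hsub _ ht') (hsub _ h0)
  have h2 : ∫ s in (0 : ℝ)..t, (A *ᵥ x (s + j * T) + B *ᵥ c) =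
      ∫ s in (0 : ℝ)..t, (A *ᵥ x (s + j * T) + B *ᵥ u (s + j * T)) := by
    refine intervalIntegral.integral_congr_ae ?_
    -- The input is prescribed on the half-open interval only; its end point is a null set.
    have hne : ∀ᵐ s : ℝ, s ≠ T := by simp [ae_iff, measure_singleton]
    filter_upwards [hne] with s hs hst
    rw [Set.uIoc_of_le ht.1] at hst
    rw [hu s ⟨hst.1.le, lt_of_le_of_ne (hst.2.trans ht.2) hs⟩]
  rw [h2, intervalIntegral.integral_comp_add_right (fun s => A *ᵥ x s + B *ᵥ u s), ← h1,
    h.eq _ ht', h.eq _ h0]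
  abel

theorem dataInt_input {ι : Type*} {u : ℝ → ι → ℝ} (hT : 0 < T) {μ : ℕ → ι → ℝ}
    (hu : ∀ j < η, ∀ t ∈ Set.Ico 0 T, u (t + j * T) = μ j) (p : ι) (j : Fin η) :
    dataInt T η u p j = T * μ j p := by
  have : ∫ τ in (0 : ℝ)..T, u (τ + (j : ℕ) * T) p = ∫ _ in (0 : ℝ)..T, μ j p := by
    refine intervalIntegral.integral_congr_ae ?_
    have hne : ∀ᵐ s : ℝ, s ≠ T := by simp [ae_iff, measure_singleton]
    filter_upwards [hne] with s hs hst
    rw [Set.uIoc_of_le hT.le] at hst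
    rw [hu j j.2 s ⟨hst.1.le, lt_of_le_of_ne hst.2 hs⟩]
  simp only [dataInt, hankelRow, of_apply]
  rw [this, intervalIntegral.integral_const, smul_eq_mul, sub_zero]

theorem mulVec_apply_integral {κ : Type*} [Fintype κ] (M : Matrix κ (Fin n) ℝ)
    {y : ℝ → Fin n → ℝ} (hT : 0 ≤ T) (hy : ContinuousOn y (Set.Icc 0 T)) (i : κ) :
    ∫ s in (0 : ℝ)..T, (M *ᵥ y s) i = (M *ᵥ fun k => ∫ s in (0 : ℝ)..T, y s k) i := by
  simp only [mulVec, dotProduct, ← intervalIntegral.integral_const_mul]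
  refine intervalIntegral.integral_finsetSum fun k _ => ContinuousOn.intervalIntegrable ?_
  rw [Set.uIcc_of_le hT]
  exact continuousOn_const.mul ((continuous_apply k).comp_continuousOn hy)

theorem IsTrajectory.dataDiff_eq (h : IsTrajectory A B x u (η * T)) (hT : 0 < T)
    {μ : ℕ → ι → ℝ} (hu : ∀ j < η, ∀ t ∈ Set.Ico 0 T, u (t + j * T) = μ j) :
    dataDiff T η x = A * dataInt T η x + B * dataInt T η u := by
  ext i j
  obtain ⟨hc, heq⟩ := h.eq_integral_sample hT j.2 (hu j j.2)
  have h1 := congrFun (heq T ⟨hT.le, le_rfl⟩) i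
  have hA : Continuous fun v : Fin n → ℝ => A *ᵥ v := by fun_prop
  have hcA : ContinuousOn (fun s => A *ᵥ x (s + (j : ℕ) * T)) (Set.uIcc 0 T) := by
    rw [Set.uIcc_of_le hT.le]; exact hA.comp_continuousOn hc
  have hint : IntervalIntegrable (fun s => A *ᵥ x (s + (j : ℕ) * T) + B *ᵥ μ j) volume 0 T :=
    (hcA.add continuousOn_const).intervalIntegrable
  have h2 : (∫ s in (0 : ℝ)..T, (A *ᵥ x (s + (j : ℕ) * T) + B *ᵥ μ j)) i =
      ∫ s in (0 : ℝ)..T, (A *ᵥ x (s + (j : ℕ) * T) + B *ᵥ μ j) i :=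
    ((ContinuousLinearMap.proj (R := ℝ) (φ := fun _ : Fin n => ℝ)
      i).intervalIntegral_comp_comm hint).symm
  simp only [Pi.add_apply] at h1 h2
  have hcAi : IntervalIntegrable (fun s => (A *ᵥ x (s + (j : ℕ) * T)) i) volume 0 T :=
    ((continuous_apply i).comp_continuousOn hcA).intervalIntegrable
  rw [h2, intervalIntegral.integral_add hcAi intervalIntegrable_const,
    mulVec_apply_integral A hT.le hc, intervalIntegral.integral_const, sub_zero, smul_eq_mul] at h1
  have h3 : (B * dataInt T η u) i j = T * (B *ᵥ μ j) i := by
    simp only [mul_apply, dataInt_input hT hu, mulVec, dotProduct, Finset.mul_sum]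
    exact Finset.sum_congr rfl fun k _ => by ring
  rw [Matrix.add_apply, h3, dataDiff, Matrix.sub_apply]
  simp only [hankelRow, of_apply]
  rw [h1, add_sub_cancel_left]
  rfl

/-- The data matrix with block rows `H_S(x)` and `H_S(u)` has full row rank. -/
theorem IsTrajectory.exists_data_eq (hAB : IsControllable A B)
    (h : IsTrajectory A B x u (η * T)) (hT : 0 < T) (hpe : IsPCPE A T η (n + 1) u)
    (a : Fin n → ℝ) (b : ι → ℝ) :
    ∃ γ, dataInt T η x *ᵥ γ = a ∧ dataInt T η u *ᵥ γ = b := by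
  obtain ⟨μ, hu, hrank, hpath⟩ := hpe
  set E := NormedSpace.exp (T • A) with hE
  set Φ := expIntegral A T with hΦ
  -- Integrating the variation of constants formula once more makes column `j` of `H_S(x)` equal to
  -- `Φ x_j + Ψ B μ_j`.
  set Ψ : Matrix (Fin n) (Fin n) ℝ :=
    Matrix.of fun i k => ∫ s in (0 : ℝ)..T, expIntegral A s i k with hΨ
  have hsol : ∀ j < η, ∀ t ∈ Set.Icc 0 T, x (t + j * T) =
      NormedSpace.exp (t • A) *ᵥ x (0 + j * T) + expIntegral A t *ᵥ (B *ᵥ μ j) := by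
    intro j hj
    obtain ⟨hc, heq⟩ := h.eq_integral_sample hT hj (hu j hj)
    exact eq_exp_mulVec_add_of_eq_integral A (B *ᵥ μ j) hT.le hc heq
  have hrec : ∀ j < η, x (0 + ((j + 1 : ℕ) : ℝ) * T) =
      E *ᵥ x (0 + (j : ℝ) * T) + (Φ * B) *ᵥ μ j := by
    intro j hj
    have h1 := hsol j hj T ⟨hT.le, le_rfl⟩
    rw [← mulVec_mulVec, ← h1]
    congr 1
    push_cast
    ring
  have hexpInt : ∀ i k, Continuous fun s : ℝ => expIntegral A s i k := fun i k =>
    intervalIntegral.continuous_primitive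
      (fun a b => (continuous_exp_smul_apply A i k).intervalIntegrable a b) 0
  have hX : ∀ j : Fin η, (fun i => dataInt T η x i j) =
      Φ *ᵥ x (0 + (j : ℕ) * T) + (Ψ * B) *ᵥ μ j := by
    intro j
    funext i
    have hcongr : ∫ s in (0 : ℝ)..T, x (s + (j : ℕ) * T) i = ∫ s in (0 : ℝ)..T,
        ((∑ k, NormedSpace.exp (s • A) i k * x (0 + (j : ℕ) * T) k) +
          ∑ k, expIntegral A s i k * (B *ᵥ μ j) k) := by
      refine intervalIntegral.integral_congr fun s hs => ?_
      rw [Set.uIcc_of_le hT.le] at hs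
      simp only [hsol j j.2 s hs]
      rfl
    have hi1 : ∀ k, IntervalIntegrable
        (fun s : ℝ => NormedSpace.exp (s • A) i k * x (0 + (j : ℕ) * T) k) volume 0 T := fun k =>
      ((continuous_exp_smul_apply A i k).mul_const _).intervalIntegrable _ _
    have hi2 : ∀ k, IntervalIntegrable
        (fun s : ℝ => expIntegral A s i k * (B *ᵥ μ j) k) volume 0 T := fun k =>
      ((hexpInt i k).mul_const _).intervalIntegrable _ _
    change ∫ s in (0 : ℝ)..T, x (s + (j : ℕ) * T) i = _
    rw [hcongr, intervalIntegral.integral_add (intervalIntegrable_fun_sum fun k _ => hi1 k)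
      (intervalIntegrable_fun_sum fun k _ => hi2 k),
      intervalIntegral.integral_finsetSum fun k _ => hi1 k,
      intervalIntegral.integral_finsetSum fun k _ => hi2 k]
    simp only [intervalIntegral.integral_mul_const]
    rw [← mulVec_mulVec]
    rfl
  set D : Matrix (Fin n ⊕ ι) (Fin η) ℝ := fromRows (dataInt T η x) (dataInt T η u) with hD
  obtain ⟨γ, hγ⟩ := mulVec_surjective_of_transpose_injective (M := D) (by
    intro w hw
    set a := w ∘ Sum.inl with ha
    set b := w ∘ Sum.inr with hb
    have hann : ∀ j : Fin η, a ⬝ᵥ (fun i => dataInt T η x i j) +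
        b ⬝ᵥ (fun p => dataInt T η u p j) = 0 := by
      intro j
      have := congrFun hw j
      rw [mulVec, dotProduct, Fintype.sum_sum_type] at this
      rw [dotProduct_comm a, dotProduct_comm b]
      exact this
    -- A left annihilator `(a, b)` of the integrated data becomes the annihilator `(Φᵀa, (ΨB)ᵀa + T
    -- b)` of the samples `(x_j, μ_j)`. Its vanishing gives `a = 0` by injectivity of `Φᵀ`, then `b
    -- = 0` as `T ≠ 0`.
    obtain ⟨h1, h2⟩ := eq_zero_of_annihilates_of_blockHankel_rank
      (E := E) (F := Φ * B) (η := η) (x := fun j : ℕ => x (0 + (j : ℝ) * T)) (μ := μ)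
      (a := Φᵀ *ᵥ a) (b := (Ψ * B)ᵀ *ᵥ a + T • b)
      (fun a ha => hAB.sampled hT hpath ha) hrec hrank (by
        intro j hj
        have h3 := hann ⟨j, hj⟩
        have hU : (fun p => dataInt T η u p ⟨j, hj⟩) = T • μ j :=
          funext fun p => dataInt_input hT hu p ⟨j, hj⟩
        rw [hX, hU, dotProduct_add, dotProduct_smul] at h3
        rw [add_dotProduct, smul_dotProduct, mulVec_dotProduct, mulVec_dotProduct,
          transpose_transpose, transpose_transpose, ← add_assoc]
        exact h3)
    have ha0 : a = 0 := expIntegral_transpose_injective hT hpath h1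
    rw [ha0, mulVec_zero, zero_add, smul_eq_zero] at h2
    have hb0 : b = 0 := h2.resolve_left hT.ne'
    funext s
    rcases s with i | p
    · exact congrFun ha0 i
    · exact congrFun hb0 p) (Sum.elim a b)
  rw [hD, fromRows_mulVec] at hγ
  exact ⟨γ, funext fun i => congrFun hγ (Sum.inl i), funext fun p => congrFun hγ (Sum.inr p)⟩

end Data

/-! ### From the data-driven program to the model-based one -/

section SemidefiniteProgram

variable {n N : ℕ} {m : Fin N → ℕ} {A : Matrix (Fin n) (Fin n) ℝ}
  {B : ∀ i, Matrix (Fin n) (Fin (m i)) ℝ} {Q : Matrix (Fin n) (Fin n) ℝ}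
  {R : Matrix (Σ i, Fin (m i)) (Σ i, Fin (m i)) ℝ} {T : ℝ} {η : ℕ} {x : ℝ → Fin n → ℝ}
  {u : ∀ i, ℝ → Fin (m i) → ℝ} {P : Matrix (Fin n) (Fin n) ℝ}

theorem vcat_dataInt : (vcat fun i => dataInt T η (u i)) = dataInt T η (stack u) := rfl

theorem dataL_transpose (hQ : Q.IsHermitian) (hR : R.IsHermitian) (hP : P.IsHermitian) :
    (dataL T η x u Q R P)ᵀ = dataL T η x u Q R P := by
  simp only [dataL, transpose_add, transpose_mul, transpose_transpose,
    transpose_eq_of_isHermitian hQ, transpose_eq_of_isHermitian hR,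
    transpose_eq_of_isHermitian hP, Matrix.mul_assoc]
  abel

theorem quadForm_dataL
    (hdiff : dataDiff T η x = A * dataInt T η x + hcat B * dataInt T η (stack u))
    (hP : P.IsHermitian) (γ : Fin η → ℝ) :
    γ ⬝ᵥ dataL T η x u Q R P *ᵥ γ =
      dissipation A (hcat B) Q R P (dataInt T η x *ᵥ γ) (dataInt T η (stack u) *ᵥ γ) := by
  have h1 : dataDiff T η x *ᵥ γ =
      A *ᵥ (dataInt T η x *ᵥ γ) + hcat B *ᵥ (dataInt T η (stack u) *ᵥ γ) := by
    rw [hdiff, add_mulVec, mulVec_mulVec, mulVec_mulVec]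
  simp only [dataL, vcat_dataInt, add_mulVec, dotProduct_add, ← mulVec_mulVec,
    ← mulVec_dotProduct, h1, dissipation]
  rw [← h1, dotProduct_mulVec_comm_of_isHermitian hP (dataDiff T η x *ᵥ γ)]
  ring

/-- The surjectivity `hdata` turns nonnegativity of `𝓛(P)` on all `γ` into nonnegativity of the
dissipation on all pairs; the unknown `A` and `B` enter only through `hdiff`. -/
theorem mem_sdpFeasible_iff (hQ : Q.IsHermitian) (hR : R.IsHermitian)
    (hdiff : dataDiff T η x = A * dataInt T η x + hcat B * dataInt T η (stack u))
    (hdata : ∀ a b, ∃ γ, dataInt T η x *ᵥ γ = a ∧ dataInt T η (stack u) *ᵥ γ = b) :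
    P ∈ sdpFeasible T η x u Q R ↔
      P.PosDef ∧ ∀ a b, 0 ≤ dissipation A (hcat B) Q R P a b := by
  refine and_congr_right fun hP => ⟨fun h a b => ?_, fun h => ?_⟩
  · obtain ⟨γ, rfl, rfl⟩ := hdata a b
    rw [← quadForm_dataL hdiff hP.1]
    exact quadForm_nonneg h γ
  · refine posSemidef_of_quadForm_nonneg (dataL_transpose hQ hR hP.1) fun γ => ?_
    rw [quadForm_dataL hdiff hP.1]
    exact h _ _

/-- The kernel of `𝓛(P)` consists of the data combinations that satisfy the feedback law. -/
theorem dataL_mulVec_eq_zero_iff (hR : R.PosDef)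
    (hdiff : dataDiff T η x = A * dataInt T η x + hcat B * dataInt T η (stack u))
    (hP : P.IsHermitian) (hL : (dataL T η x u Q R P).PosSemidef)
    (hric : riccati A (hcat B) Q R P = 0) (γ : Fin η → ℝ) :
    dataL T η x u Q R P *ᵥ γ = 0 ↔
      dataInt T η (stack u) *ᵥ γ = -(riccatiGain (hcat B) R P *ᵥ (dataInt T η x *ᵥ γ)) := by
  have h1 := quadForm_dataL (Q := Q) (R := R) hdiff hP γ
  rw [dissipation_eq A (hcat B) Q hR hP, hric, zero_mulVec, dotProduct_zero, zero_add] at h1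
  rw [← add_eq_zero_iff_eq_neg]
  constructor
  · intro h0
    by_contra hne
    have := quadForm_pos hR hne
    rw [← h1, h0, dotProduct_zero] at this
    exact this.false
  · intro h0
    rw [h0, zero_dotProduct] at h1
    exact mulVec_eq_zero_of_quadForm_eq_zero hL h1

theorem mulVec_col {α β γ : Type*} [Fintype β] (M : Matrix α β ℝ) (G : Matrix β γ ℝ) (k : γ) :
    M *ᵥ (fun j => G j k) = fun i => (M * G) i k := rfl

/-- Column by column, lying in the kernel of `𝓛(P)` is the feedback law, and `H_S(x)G = 1` makes the
states in it the standard basis vectors. -/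
theorem data_equation_iff (hR : R.PosDef)
    (hdiff : dataDiff T η x = A * dataInt T η x + hcat B * dataInt T η (stack u))
    (hP : P.IsHermitian) (hL : (dataL T η x u Q R P).PosSemidef)
    (hric : riccati A (hcat B) Q R P = 0) (G : Matrix (Fin η) (Fin n) ℝ) :
    fromRows (dataInt T η x) (dataL T η x u Q R P) * G = fromRows 1 0 ↔
      dataInt T η x * G = 1 ∧ dataInt T η (stack u) * G = -riccatiGain (hcat B) R P := by
  rw [fromRows_mul, fromRows_ext_iff]
  refine and_congr_right fun hX => ?_
  have hcol : ∀ k, dataInt T η x *ᵥ (fun j => G j k) = Pi.single k 1 := fun k => by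
    rw [mulVec_col, hX]
    funext i
    simp [Matrix.one_apply, Pi.single_apply]
  have hiff := fun k => dataL_mulVec_eq_zero_iff hR hdiff hP hL hric fun j => G j k
  simp only [hcol, mulVec_single_one, mulVec_col] at hiff
  constructor
  · intro h0
    ext p k
    exact congrFun ((hiff k).1 (by rw [h0]; rfl)) p
  · intro h0
    ext j k
    exact congrFun ((hiff k).2 (by rw [h0]; rfl)) j

theorem blockRow_of_blockDiagonal'_mul {Rd : ∀ i, Matrix (Fin (m i)) (Fin (m i)) ℝ}
    (hR : (blockDiagonal' Rd).PosDef) {K : ∀ i, Matrix (Fin (m i)) (Fin n) ℝ}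
    (h : blockDiagonal' Rd * vcat K = (hcat B)ᵀ * P) (i : Fin N) :
    K i = (Rd i)⁻¹ * (B i)ᵀ * P := by
  have hRi : (Rd i).PosDef := by
    have := hR.submatrix (e := fun k : Fin (m i) => (⟨i, k⟩ : Σ i, Fin (m i)))
      (fun a b hab => by simpa using hab)
    rwa [show (blockDiagonal' Rd).submatrix _ _ = Rd i by ext; simp] at this
  have hi : Rd i * K i = (B i)ᵀ * P := by
    ext p k
    have h1 := congrFun (congrFun h ⟨i, p⟩) k
    rw [mul_apply, Fintype.sum_sigma, Finset.sum_eq_single i] at h1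
    · simpa [mul_apply, vcat, hcat, blockDiagonal'_apply_eq] using h1
    · intro l _ hl
      refine Finset.sum_eq_zero fun q _ => ?_
      rw [blockDiagonal'_apply_ne _ _ _ hl.symm, zero_mul]
    · simp
  rw [Matrix.mul_assoc, ← hi, Matrix.nonsing_inv_mul_cancel_left]
  exact (isUnit_iff_isUnit_det _).1 hRi.isUnit

end SemidefiniteProgram

end

end DataLQR

/-! ### The main theorem -/

open DataLQR
theorem lemma3 {n N : ℕ} {m : Fin N → ℕ}
    (A : Matrix (Fin n) (Fin n) ℝ) (B : ∀ i, Matrix (Fin n) (Fin (m i)) ℝ)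
    (Q : Matrix (Fin n) (Fin n) ℝ) (R : Matrix (Σ i, Fin (m i)) (Σ i, Fin (m i)) ℝ)
    (hQ : Q.PosSemidef) (hR : R.PosDef)
    (hctrl : IsControllable A (hcat B))
    -- the collected data: an input-state trajectory on `[0, ηT]` with a PCPE input of order `n + 1`
    (T : ℝ) (hT : 0 < T) (η : ℕ)
    (x : ℝ → Fin n → ℝ) (u : ∀ i, ℝ → Fin (m i) → ℝ)
    (htraj : IsTrajectory A (hcat B) x (stack u) (η * T))
    (hpe : IsPCPE A T η (n + 1) (stack u))
    (P : Matrix (Fin n) (Fin n) ℝ) (hP : IsSDPSolution T η x u Q R P) :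
    (∃ Γ : Matrix (Fin η) (Fin n) ℝ,
      Matrix.fromRows (dataInt T η x) (dataL T η x u Q R P) * Γ = Matrix.fromRows 1 0) ∧
    ∀ Γ : Matrix (Fin η) (Fin n) ℝ,
      Matrix.fromRows (dataInt T η x) (dataL T η x u Q R P) * Γ = Matrix.fromRows 1 0 →
    ∀ K : ∀ i, Matrix (Fin (m i)) (Fin n) ℝ, (∀ i, K i = -(dataInt T η (u i) * Γ)) →
      -- `K` is the unique optimal gain of the LQR problem over stable trajectories
      (∀ K', IsOptimalGain (stablePairs A (hcat B)) Q R K' ↔ K' = vcat K) ∧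
      -- and over all trajectories, if `(A, Q)` is detectable
      (IsDetectable A Q → ∀ K', IsOptimalGain (allPairs A (hcat B)) Q R K' ↔ K' = vcat K) ∧
      vcat K = R⁻¹ * (hcat B).transpose * P ∧
      (∀ Rd : ∀ i, Matrix (Fin (m i)) (Fin (m i)) ℝ, R = Matrix.blockDiagonal' Rd →
        ∀ i, K i = (Rd i)⁻¹ * (B i).transpose * P) := by
  have hdata := htraj.exists_data_eq hctrl hT hpe
  obtain ⟨μ, hu, -⟩ := hpe
  have hdiff := htraj.dataDiff_eq hT hu
  have hfeas := fun P' => mem_sdpFeasible_iff (P := P') hQ.1 hR.1 hdiff hdata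
  obtain ⟨⟨hPpos, hL⟩, hmax⟩ := hP
  have hric : riccati A (hcat B) Q R P = 0 :=
    riccati_eq_zero_of_trace_max hQ.1 hR hPpos ((hfeas P).1 ⟨hPpos, hL⟩).2
      fun P' h1 h2 => hmax ((hfeas P').2 ⟨h1, h2⟩)
  have hiff := data_equation_iff hR hdiff hPpos.1 hL hric
  refine ⟨?_, fun Γ hΓ K hK => ?_⟩
  -- Column `k` of `Γ` combines the data into the state `e_k` paired with its feedback input `-K
  -- e_k`.
  · choose γ h1 h2 using fun k : Fin n =>
      hdata (Pi.single k 1) (-((riccatiGain (hcat B) R P).mulVec (Pi.single k 1)))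
    refine ⟨Matrix.of fun j k => γ k j, (hiff _).2 ⟨?_, ?_⟩⟩
    · ext i k
      have := congrFun (h1 k) i
      rw [Pi.single_apply] at this
      rw [Matrix.one_apply]
      exact this
    · ext p k
      have := congrFun (h2 k) p
      rw [Matrix.mulVec_single_one] at this
      exact this
  · have hKeq : vcat K = riccatiGain (hcat B) R P := by
      have h1 : vcat K = -(dataInt T η (stack u) * Γ) := by
        ext p k
        exact congrFun (congrFun (hK p.1) p.2) k
      rw [h1, ((hiff Γ).1 hΓ).2, neg_neg]
    refine ⟨fun K' => ?_, fun hdet K' => ?_, hKeq, fun Rd hRd i => ?_⟩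
    · rw [hKeq]
      exact isOptimalGain_iff_eq_riccatiGain hQ hR hPpos hctrl hric (fun _ => subset_rfl)
        (fun _ _ hp => hp.1) (fun _ _ hp _ _ hε => exists_quadForm_lt_of_tendsto hp.2 hε) K'
    · rw [hKeq]
      exact isOptimalGain_iff_eq_riccatiGain hQ hR hPpos hctrl hric (fun _ _ hp => hp.1)
        (fun _ => subset_rfl) (fun _ _ hp hcost _ hε =>
          (hdet.isObservable hR hPpos hric).exists_quadForm_lt hQ hR hp.2 hcost hε) K'
    · subst hRd
      refine blockRow_of_blockDiagonal'_mul hR ?_ i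
      rw [hKeq, mul_riccatiGain (hcat B) hR]
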